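/- Algebras of the similarity type of relation algebras have binary operations $+,\cdot,;$, unary operations $-,\breve{\ }$ and constants $0,1,1'$. Let $\mathsf{RRA}$ be the class of representable relation algebras, i.e. of the algebras of this type that are isomorphic to an algebra of binary relations contained in an equivalence relation $E$ on a set $U$, where the operations are union, intersection, composition of relations, complement relative to $E$ and converse, and the constants are $\emptyset$, $E$ and the identity relation on $U$. The length of an equation is the total number of occurrences of operation symbols and variables in it. Let $\beta(m)$ be the least $N\in\mathbb{N}$ such that every algebra $A$ of this type with $|A|\le m$ satisfies: $A\in\mathsf{RRA}$ if and only if $A$ satisfies all equations of length at most $N$ that are true in $\mathsf{RRA}$. Let $\beta^*(M)$ be the least $N\in\mathbb{N}$ with the same property for all finite relation algebras $A$ (in the sense of Tarski's axioms) with at most $M$ atoms. Then $\beta(m)$ and $\beta^*(M)$ exist for all $m,M\in\mathbb{N}$, and: 1. for every integer $n\ge 0$, $\ \beta\bigl(2^{2\cdot 3^{2n+1}+2}\bigr) > 2\log_2 3\cdot(2n+1)-2$; 2. for every integer $m\ge 2^8$, $\ \beta(m) > 2\log_2 3\cdot\bigl(\log_3(\tfrac12\log_2 m-1)-2\bigr)-2$;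 in particular $\beta$ grows at least like a log-log function, i.e. $\log\log m = O(\beta(m))$ as $m\to\infty$; 3. for every integer $M\ge 3$, $\ \beta^*(M) > 2\log_2 3\cdot\bigl(\log_3(\tfrac M2-1)-2\bigr)-2$. -/

import Mathlib

/-- An algebra of the similarity type of relation algebras: a set with binary operations
`+`, `·`, `;`, unary operations `-`, `˘`, and constants `0`, `1`, `1'`. No law is required. -/
class RelAlg (A : Type) where
  /-- Boolean sum `x + y` -/
  add : A → A → A
  /-- Boolean product `x · y` -/
  mul : A → A → A
  /-- Boolean complement `-x` -/
  compl : A → A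
  /-- Boolean zero `0` -/
  zero : A
  /-- Boolean unit `1` -/
  one : A
  /-- relative product (composition) `x ; y` -/
  comp : A → A → A
  /-- converse `x˘` -/
  conv : A → A
  /-- identity element `1'` -/
  ident : A

/-- Terms of this similarity type over the variables `x₀, x₁, x₂, …`. -/
inductive RelTerm where
  | var : ℕ → RelTerm
  | add : RelTerm → RelTerm → RelTerm
  | mul : RelTerm → RelTerm → RelTerm
  | compl : RelTerm → RelTerm
  | zero : RelTerm
  | one : RelTerm
  | comp : RelTerm → RelTerm → RelTerm
  | conv : RelTerm → RelTerm
  | ident : RelTerm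

/-- The total number of occurrences of operation symbols and variables in a term. -/
def RelTerm.length : RelTerm → ℕ
  | .var _ => 1
  | .add s t => s.length + t.length + 1
  | .mul s t => s.length + t.length + 1
  | .compl t => t.length + 1
  | .zero => 1
  | .one => 1
  | .comp s t => s.length + t.length + 1
  | .conv t => t.length + 1
  | .ident => 1

/-- The value of a term in an algebra under an assignment of the variables. -/
def RelTerm.eval {A : Type} [RelAlg A] (v : ℕ → A) : RelTerm → A
  | .var i => v i
  | .add s t => RelAlg.add (s.eval v) (t.eval v)
  | .mul s t => RelAlg.mul (s.eval v) (t.eval v)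
  | .compl t => RelAlg.compl (t.eval v)
  | .zero => RelAlg.zero
  | .one => RelAlg.one
  | .comp s t => RelAlg.comp (s.eval v) (t.eval v)
  | .conv t => RelAlg.conv (t.eval v)
  | .ident => RelAlg.ident

/-- An equation `lhs = rhs` between terms. -/
structure RelEquation where
  lhs : RelTerm
  rhs : RelTerm

/-- The length of an equation: the total number of occurrences of operation symbols and
variables on its two sides. -/
def RelEquation.length (e : RelEquation) : ℕ := e.lhs.length + e.rhs.length

/-- The algebra `A` satisfies the equation `e`. -/
def RelEquation.Holds (e : RelEquation) (A : Type) [RelAlg A] : Prop :=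
  ∀ v : ℕ → A, e.lhs.eval v = e.rhs.eval v

/-- The equation `e` is true in the class `V` of algebras. -/
def RelEquation.TrueIn (e : RelEquation) (V : ∀ (A : Type) [RelAlg A], Prop) : Prop :=
  ∀ (B : Type) [RelAlg B], V B → e.Holds B

/-- `A` satisfies all the equations true in `V` of length at most `N`. -/
def SatisfiesUpTo (V : ∀ (A : Type) [RelAlg A], Prop) (N : ℕ) (A : Type) [RelAlg A] : Prop :=
  ∀ e : RelEquation, e.length ≤ N → e.TrueIn V → e.Holds A

/-- The set of those `N` for which the equations of length at most `N` true in `V` decide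
membership in `V` for all algebras (of the similarity type) with at most `m` elements. -/
def complexityBounds (V : ∀ (A : Type) [RelAlg A], Prop) (m : ℕ) : Set ℕ :=
  {N | ∀ (A : Type) [RelAlg A], Finite A → Nat.card A ≤ m → (V A ↔ SatisfiesUpTo V N A)}

/-- The equational complexity function `β_V` of the class `V`. -/
noncomputable def eqComplexity (V : ∀ (A : Type) [RelAlg A], Prop) (m : ℕ) : ℕ :=
  sInf (complexityBounds V m)

/-- `h` is a representation of `A` as an algebra of binary relations on the set `U`: an
isomorphism of `A` onto an algebra of subrelations of an equivalence relation `E` on `U`, with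
union, intersection, complement relative to `E`, the empty relation, `E`, composition of
relations, converse of relations and the identity relation on `U`. -/
structure IsRepresentation {A : Type} [RelAlg A] {U : Type} (E : Set (U × U))
    (h : A → Set (U × U)) : Prop where
  equivalence : Equivalence fun x y : U => (x, y) ∈ E
  injective : Function.Injective h
  subset : ∀ a, h a ⊆ E
  map_add : ∀ a b, h (RelAlg.add a b) = h a ∪ h b
  map_mul : ∀ a b, h (RelAlg.mul a b) = h a ∩ h b
  map_compl : ∀ a, h (RelAlg.compl a) = E \ h a
  map_zero : h RelAlg.zero = ∅
  map_one : h RelAlg.one = E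
  map_comp : ∀ a b, h (RelAlg.comp a b) = {p | ∃ y, (p.1, y) ∈ h a ∧ (y, p.2) ∈ h b}
  map_conv : ∀ a, h (RelAlg.conv a) = {p | (p.2, p.1) ∈ h a}
  map_ident : h RelAlg.ident = {p | p.1 = p.2}

/-- `RRA`, the class of representable relation algebras. -/
def RRA (A : Type) [RelAlg A] : Prop :=
  ∃ (U : Type) (E : Set (U × U)) (h : A → Set (U × U)), IsRepresentation E h

open RelAlg in
/-- `A` is a relation algebra: a Boolean algebra (Huntington's axioms) that satisfies Tarski's
axioms for composition, converse and the identity element. -/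
structure IsRelationAlgebra (A : Type) [RelAlg A] : Prop where
  add_comm : ∀ x y : A, add x y = add y x
  mul_comm : ∀ x y : A, mul x y = mul y x
  add_mul_distrib : ∀ x y z : A, add x (mul y z) = mul (add x y) (add x z)
  mul_add_distrib : ∀ x y z : A, mul x (add y z) = add (mul x y) (mul x z)
  add_zero : ∀ x : A, add x zero = x
  mul_one : ∀ x : A, mul x one = x
  add_compl : ∀ x : A, add x (compl x) = one
  mul_compl : ∀ x : A, mul x (compl x) = zero
  comp_assoc : ∀ x y z : A, comp (comp x y) z = comp x (comp y z)
  add_comp : ∀ x y z : A, comp (add x y) z = add (comp x z) (comp y z)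
  comp_ident : ∀ x : A, comp x ident = x
  conv_conv : ∀ x : A, conv (conv x) = x
  conv_add : ∀ x y : A, conv (add x y) = add (conv x) (conv y)
  conv_comp : ∀ x y : A, conv (comp x y) = comp (conv y) (conv x)
  tarski : ∀ x y : A, add (comp (conv x) (compl (comp x y))) (compl y) = compl y

/-- The atoms of (the Boolean part of) `A`: the minimal nonzero elements, where `x ≤ a` means
`x · a = x`. -/
def relAtoms (A : Type) [RelAlg A] : Set A :=
  {a | a ≠ RelAlg.zero ∧ ∀ x : A, RelAlg.mul x a = x → x = RelAlg.zero ∨ x = a}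

/-- The set of those `N` for which the equations of length at most `N` true in `V` decide
membership in `V` for all finite relation algebras with at most `M` atoms. -/
def atomComplexityBounds (V : ∀ (A : Type) [RelAlg A], Prop) (M : ℕ) : Set ℕ :=
  {N | ∀ (A : Type) [RelAlg A], Finite A → IsRelationAlgebra A → (relAtoms A).ncard ≤ M →
    (V A ↔ SatisfiesUpTo V N A)}

/-- The equational complexity function `β*_V`, whose argument is the number of atoms of a finite
relation algebra rather than its cardinality. -/
noncomputable def atomEqComplexity (V : ∀ (A : Type) [RelAlg A], Prop) (M : ℕ) : ℕ :=
  sInf (atomComplexityBounds V M)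

/-! Existence. Let variables name the elements of a finite algebra `A`, and let `τ` be the sum of
the symmetric differences of the two sides of every entry of its operation tables. For each element
`a` take the equation `x_a ≤ 1 ; τ ; 1`, of length quadratic in `|A|`. Under the naming assignment
`τ` is zero, so for `a ≠ 0` the equation fails in `A`, granted a few short identities of `RRA`. If
`A` satisfies all short equations of `RRA`, the equation must therefore fail in some representable
algebra: some pair in `x_a` avoids `1 ; τ ; 1`, and on the equivalence class of that pair all tables
of `A` are respected. This gives a homomorphism of `A` into the relations on that class, nonempty at
`a`; the disjoint union over all `a ≠ 0` represents `A`. For `β*`, a finite relation algebra with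
`M` atoms has at most `2 ^ M` elements.

Lower bounds. The witnesses are the Lyndon algebras of a line with `q + 1` points, `q = 2 · 3 ^
(2n+1)`. A representation amounts to an affine plane of order `q` whose directions are the points of
the line. Since `q ≡ 2 (mod 4)`, Bruck–Ryser would make `q z² = 1 + t²` solvable in rationals, which
the odd exponent of `3` forbids (`not_lyndon_RRA`).

Yet the algebra satisfies every equation of `RRA` in `k` variables if `2 ^ k < q + 1`. By pigeonhole
no variable separates some two points `p ≠ r`. Replacing `p` by infinitely many points then embeds
the elements not separating `p` and `r` into the Lyndon algebra of the rational line, which the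
slopes of `ℚ × ℚ` represent (`lyndon_holds_of_card_vars`). An equation in `k` variables has length
at least `2k - 2`, so a sufficient `N` exceeds about `2 log₂ q`. -/

/-! ### Existence of `β`: finite algebras and their diagram equations -/

/-- The symmetric difference of two terms. -/
def RelTerm.symmDiff (s t : RelTerm) : RelTerm :=
  .add (.mul s (.compl t)) (.mul (.compl s) t)

/-- The sum of the symmetric differences of a list of pairs of terms. -/
def RelTerm.sumSymmDiff : List (RelTerm × RelTerm) → RelTerm
  | [] => .zero
  | p :: l => .add (p.1.symmDiff p.2) (sumSymmDiff l)

lemma RelTerm.sumSymmDiff_length (l : List (RelTerm × RelTerm))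
    (hl : ∀ p ∈ l, p.1.length + p.2.length ≤ 5) : (sumSymmDiff l).length ≤ 16 * l.length + 1 := by
  induction l with
  | nil => simp [sumSymmDiff, RelTerm.length]
  | cons p l ih =>
    have h1 := hl p (by simp)
    have h2 := ih fun q hq => hl q (by simp [hq])
    simp only [sumSymmDiff, symmDiff, RelTerm.length, List.length_cons]
    omega

lemma IsRepresentation.mem_sumSymmDiff {A U : Type} [RelAlg A] {E : Set (U × U)}
    {h : A → Set (U × U)} (H : IsRepresentation E h) (v : ℕ → A) (l : List (RelTerm × RelTerm))
    {q : RelTerm × RelTerm} (hq : q ∈ l) {p : U × U} (hp : p ∈ E)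
    (hne : ¬ (p ∈ h (q.1.eval v) ↔ p ∈ h (q.2.eval v))) :
    p ∈ h ((RelTerm.sumSymmDiff l).eval v) := by
  induction l with
  | nil => simp at hq
  | cons r l ih =>
    simp only [RelTerm.sumSymmDiff, RelTerm.symmDiff, RelTerm.eval, H.map_add, H.map_mul,
      H.map_compl]
    rcases List.mem_cons.1 hq with rfl | hq
    · simp only [Set.mem_union, Set.mem_inter_iff, Set.mem_sdiff]
      tauto
    · exact Or.inr (ih hq)

lemma RelEquation.trueIn_RRA {e : RelEquation}
    (he : ∀ (B U : Type) [RelAlg B] (E : Set (U × U)) (h : B → Set (U × U)),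
      IsRepresentation E h → ∀ v : ℕ → B, h (e.lhs.eval v) = h (e.rhs.eval v)) :
    e.TrueIn RRA := by
  rintro B _ ⟨U, E, h, H⟩ v
  exact H.injective (he B U E h H v)

/-- A homomorphism of `A` into the algebra of all binary relations on `U`. -/
structure IsSquareHom {A : Type} [RelAlg A] {U : Type} (h : A → Set (U × U)) : Prop where
  map_add : ∀ a b, h (RelAlg.add a b) = h a ∪ h b
  map_mul : ∀ a b, h (RelAlg.mul a b) = h a ∩ h b
  map_compl : ∀ a, h (RelAlg.compl a) = (h a)ᶜ
  map_zero : h RelAlg.zero = ∅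
  map_one : h RelAlg.one = Set.univ
  map_comp : ∀ a b, h (RelAlg.comp a b) = {p | ∃ y, (p.1, y) ∈ h a ∧ (y, p.2) ∈ h b}
  map_conv : ∀ a, h (RelAlg.conv a) = {p | (p.2, p.1) ∈ h a}
  map_ident : h RelAlg.ident = {p | p.1 = p.2}

/-- A family of square homomorphisms that separates the elements of `A` from zero and whose
Boolean operations are well behaved gives a representation on the disjoint union. -/
lemma RRA_of_squareHoms {A : Type} [RelAlg A]
    (hA : ∀ a b : A, RelAlg.mul a (RelAlg.compl b) = RelAlg.zero →
      RelAlg.mul (RelAlg.compl a) b = RelAlg.zero → a = b)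
    (hsep : ∀ a : A, a ≠ RelAlg.zero → ∃ (U : Type) (h : A → Set (U × U)),
      IsSquareHom h ∧ (h a).Nonempty) : RRA A := by
  choose U h H hne using hsep
  let I := {a : A // a ≠ RelAlg.zero}
  let V := Σ i : I, U i.1 i.2
  let g : A → Set (V × V) := fun b =>
    {p | ∃ (i : I) (x y : U i.1 i.2), p = (⟨i, x⟩, ⟨i, y⟩) ∧ (x, y) ∈ h i.1 i.2 b}
  have mem_g : ∀ (b : A) (i : I) (x y : U i.1 i.2),
      ((⟨i, x⟩, ⟨i, y⟩) : V × V) ∈ g b ↔ (x, y) ∈ h i.1 i.2 b := by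
    intro b i x y
    constructor
    · rintro ⟨j, x', y', hp, hm⟩
      obtain ⟨h1, h2⟩ := Prod.mk.inj hp
      obtain ⟨rfl, hx⟩ := Sigma.mk.inj h1
      have hy := (Sigma.mk.inj h2).2
      rw [eq_of_heq hx, eq_of_heq hy]
      exact hm
    · exact fun hm => ⟨i, x, y, rfl, hm⟩
  have g_fst : ∀ (b : A) (p : V × V), p ∈ g b → p.1.1 = p.2.1 := by
    rintro b p ⟨i, x, y, rfl, -⟩
    rfl
  have g_ext : ∀ (b : A) (S : Set (V × V)), (∀ p ∈ S, p.1.1 = p.2.1) →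
      (∀ (i : I) (x y : U i.1 i.2), (x, y) ∈ h i.1 i.2 b ↔ ((⟨i, x⟩, ⟨i, y⟩) : V × V) ∈ S) →
      g b = S := by
    intro b S hS hiff
    ext ⟨⟨i, x⟩, ⟨j, y⟩⟩
    constructor
    · intro hp
      obtain rfl : i = j := g_fst b _ hp
      exact (hiff i x y).1 ((mem_g b i x y).1 hp)
    · intro hp
      obtain rfl : i = j := hS _ hp
      exact (mem_g b i x y).2 ((hiff i x y).2 hp)
  let E : Set (V × V) := {p | p.1.1 = p.2.1}
  have hmul : ∀ a b, g (RelAlg.mul a b) = g a ∩ g b := fun a b => by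
    refine g_ext _ _ (fun p hp => g_fst a p hp.1) fun i x y => ?_
    rw [(H i.1 i.2).map_mul]
    exact (and_congr (mem_g a i x y) (mem_g b i x y)).symm
  have hcompl : ∀ a, g (RelAlg.compl a) = E \ g a := fun a => by
    refine g_ext _ _ (fun p hp => hp.1) fun i x y => ?_
    rw [(H i.1 i.2).map_compl, Set.mem_sdiff, mem_g, Set.mem_compl_iff]
    exact ⟨fun hm => ⟨rfl, hm⟩, fun hm => hm.2⟩
  have hzero : ∀ c, g c = ∅ → c = RelAlg.zero := by
    intro c hc
    by_contra hc0
    obtain ⟨⟨x, y⟩, hp⟩ := hne c hc0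
    have : ((⟨⟨c, hc0⟩, x⟩, ⟨⟨c, hc0⟩, y⟩) : V × V) ∈ g c := (mem_g c ⟨c, hc0⟩ x y).2 hp
    rw [hc] at this
    exact this
  refine ⟨V, E, g, ⟨⟨fun _ => rfl, fun hp => hp.symm, fun hp hq => hp.trans hq⟩, ?_, g_fst,
    ?_, hmul, hcompl, ?_, ?_, ?_, ?_, ?_⟩⟩
  · intro a b hab
    apply hA <;> apply hzero <;> rw [hmul, hcompl, hab] <;> ext p <;>
      simp only [Set.mem_inter_iff, Set.mem_sdiff, Set.mem_empty_iff_false] <;> tauto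
  · intro a b
    refine g_ext _ _ (fun p hp => hp.elim (g_fst a p) (g_fst b p)) fun i x y => ?_
    rw [(H i.1 i.2).map_add]
    exact (or_congr (mem_g a i x y) (mem_g b i x y)).symm
  · exact g_ext _ _ (fun p hp => hp.elim) fun i x y => by rw [(H i.1 i.2).map_zero]; simp
  · exact g_ext _ _ (fun p hp => hp) fun i x y => by
      rw [(H i.1 i.2).map_one]; exact ⟨fun _ => rfl, fun _ => trivial⟩
  · intro a b
    refine g_ext _ _ ?_ fun i x y => ?_
    · rintro p ⟨z, h1, h2⟩
      exact (g_fst _ _ h1).trans (g_fst _ _ h2)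
    · rw [(H i.1 i.2).map_comp]
      constructor
      · rintro ⟨z, h1, h2⟩
        exact ⟨⟨i, z⟩, (mem_g _ _ _ _).2 h1, (mem_g _ _ _ _).2 h2⟩
      · rintro ⟨⟨j, z⟩, h1, h2⟩
        obtain rfl : i = j := g_fst _ _ h1
        exact ⟨z, (mem_g _ _ _ _).1 h1, (mem_g _ _ _ _).1 h2⟩
  · intro a
    refine g_ext _ _ (fun p hp => (g_fst _ _ hp).symm) fun i x y => ?_
    rw [(H i.1 i.2).map_conv]
    exact (mem_g a i y x).symm
  · refine g_ext _ _ (fun p hp => congrArg Sigma.fst hp) fun i x y => ?_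
    rw [(H i.1 i.2).map_ident]
    constructor
    · rintro (rfl : x = y)
      rfl
    · intro hp
      exact eq_of_heq (Sigma.mk.inj (show (⟨i, x⟩ : V) = ⟨i, y⟩ from hp)).2

/-- The operation tables of a finite algebra, as a list of pairs of terms. -/
noncomputable def diagramList (A : Type) [RelAlg A] [Fintype A] (idx : A → ℕ) :
    List (RelTerm × RelTerm) :=
  ((Finset.univ : Finset (A × A)).toList.map fun p =>
      (.add (.var (idx p.1)) (.var (idx p.2)), .var (idx (RelAlg.add p.1 p.2)))) ++
  ((Finset.univ : Finset (A × A)).toList.map fun p =>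
      (.mul (.var (idx p.1)) (.var (idx p.2)), .var (idx (RelAlg.mul p.1 p.2)))) ++
  ((Finset.univ : Finset (A × A)).toList.map fun p =>
      (.comp (.var (idx p.1)) (.var (idx p.2)), .var (idx (RelAlg.comp p.1 p.2)))) ++
  ((Finset.univ : Finset A).toList.map fun a =>
      (.compl (.var (idx a)), .var (idx (RelAlg.compl a)))) ++
  ((Finset.univ : Finset A).toList.map fun a =>
      (.conv (.var (idx a)), .var (idx (RelAlg.conv a)))) ++
  [(.zero, .var (idx RelAlg.zero)), (.one, .var (idx RelAlg.one)),
    (.ident, .var (idx RelAlg.ident))]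

lemma diagramList_length (A : Type) [RelAlg A] [Fintype A] (idx : A → ℕ) :
    (diagramList A idx).length = 3 * Fintype.card A ^ 2 + 2 * Fintype.card A + 3 := by
  simp only [diagramList, List.length_append, List.length_map, Finset.length_toList,
    Finset.card_univ, Fintype.card_prod, List.length_cons, List.length_nil]
  ring

lemma length_le_of_mem_diagramList {A : Type} [RelAlg A] [Fintype A] {idx : A → ℕ}
    {p : RelTerm × RelTerm} (hp : p ∈ diagramList A idx) : p.1.length + p.2.length ≤ 5 := by
  simp only [diagramList, List.mem_append, List.mem_map, List.mem_cons, List.not_mem_nil,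
    or_false] at hp
  rcases hp with ((((⟨_, -, rfl⟩ | ⟨_, -, rfl⟩) | ⟨_, -, rfl⟩) | ⟨_, -, rfl⟩) | ⟨_, -, rfl⟩) |
    rfl | rfl | rfl <;> simp [RelTerm.length]

lemma eval_of_mem_diagramList {A : Type} [RelAlg A] [Fintype A] {idx : A → ℕ} {v : ℕ → A}
    (hv : ∀ a, v (idx a) = a) {p : RelTerm × RelTerm} (hp : p ∈ diagramList A idx) :
    p.1.eval v = p.2.eval v := by
  simp only [diagramList, List.mem_append, List.mem_map, List.mem_cons, List.not_mem_nil,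
    or_false] at hp
  rcases hp with ((((⟨_, -, rfl⟩ | ⟨_, -, rfl⟩) | ⟨_, -, rfl⟩) | ⟨_, -, rfl⟩) | ⟨_, -, rfl⟩) |
    rfl | rfl | rfl <;> simp [RelTerm.eval, hv]

/-- A length of equations that suffices for algebras with at most `m` elements. -/
def sufficientLength (m : ℕ) : ℕ := 16 * (3 * m ^ 2 + 2 * m + 3) + 20

/-- The equation `x ≤ 1 ; τ ; 1`, where `τ` measures the failure of the operation tables. -/
noncomputable def diagramEquation (A : Type) [RelAlg A] [Fintype A] (idx : A → ℕ) (a : A) :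
    RelEquation :=
  ⟨.mul (.var (idx a)) (.comp .one (.comp (RelTerm.sumSymmDiff (diagramList A idx)) .one)),
    .var (idx a)⟩

/-- A failure of the equation is a pair `(x, y)` outside `1 ; τ ; 1`. Any table entry violated
inside the equivalence class of `x` would put `(x, y)` into `1 ; τ ; 1`, so reading the variables on
that class is a homomorphism. -/
lemma exists_squareHom_of_not_trueIn {A : Type} [RelAlg A] [Fintype A] {idx : A → ℕ}
    (hidx : Function.Injective idx) {a : A} (hna : ¬ (diagramEquation A idx a).TrueIn RRA) :
    ∃ (U : Type) (h : A → Set (U × U)), IsSquareHom h ∧ (h a).Nonempty := by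
  by_contra hcon
  refine hna (RelEquation.trueIn_RRA fun B U _ E h H v => ?_)
  simp only [diagramEquation, RelTerm.eval, H.map_mul, H.map_comp, H.map_one]
  refine Set.inter_eq_left.2 ?_
  rintro ⟨x, y⟩ hxy
  by_contra hnot
  apply hcon
  have hE := H.equivalence
  have hxyE : (x, y) ∈ E := H.subset _ hxy
  let C := {u : U // (x, u) ∈ E}
  have hCE : ∀ u w : C, (u.1, w.1) ∈ E := fun u w => hE.trans (hE.symm u.2) w.2
  have key : ∀ q ∈ diagramList A idx, ∀ u w : C,
      ((u.1, w.1) ∈ h (q.1.eval v) ↔ (u.1, w.1) ∈ h (q.2.eval v)) := by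
    intro q hq u w
    by_contra hne
    exact hnot ⟨u.1, u.2, w.1, H.mem_sumSymmDiff v _ hq (hCE u w) hne,
      hE.trans (hE.symm w.2) hxyE⟩
  refine ⟨C, fun b => {p | (p.1.1, p.2.1) ∈ h (v (idx b))}, ⟨?_, ?_, ?_, ?_, ?_, ?_, ?_, ?_⟩,
    ⟨(⟨x, hE.refl x⟩, ⟨y, hxyE⟩), hxy⟩⟩
  · intro b c
    ext ⟨u, w⟩
    have := key (.add (.var (idx b)) (.var (idx c)), .var (idx (RelAlg.add b c)))
      (by simp [diagramList, hidx.eq_iff]) u w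
    simp only [RelTerm.eval, H.map_add] at this
    exact this.symm
  · intro b c
    ext ⟨u, w⟩
    have := key (.mul (.var (idx b)) (.var (idx c)), .var (idx (RelAlg.mul b c)))
      (by simp [diagramList, hidx.eq_iff]) u w
    simp only [RelTerm.eval, H.map_mul] at this
    exact this.symm
  · intro b
    ext ⟨u, w⟩
    have := key (.compl (.var (idx b)), .var (idx (RelAlg.compl b)))
      (by simp [diagramList, hidx.eq_iff]) u w
    simp only [RelTerm.eval, H.map_compl] at this
    exact this.symm.trans ⟨fun hp => hp.2, fun hp => ⟨hCE u w, hp⟩⟩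
  · ext ⟨u, w⟩
    have := key (.zero, .var (idx RelAlg.zero)) (by simp [diagramList, hidx.eq_iff]) u w
    simp only [RelTerm.eval, H.map_zero] at this
    exact this.symm
  · ext ⟨u, w⟩
    have := key (.one, .var (idx RelAlg.one)) (by simp [diagramList, hidx.eq_iff]) u w
    simp only [RelTerm.eval, H.map_one] at this
    exact this.symm.trans ⟨fun _ => trivial, fun _ => hCE u w⟩
  · intro b c
    ext ⟨u, w⟩
    have := key (.comp (.var (idx b)) (.var (idx c)), .var (idx (RelAlg.comp b c)))
      (by simp [diagramList, hidx.eq_iff]) u w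
    simp only [RelTerm.eval, H.map_comp] at this
    refine this.symm.trans ⟨?_, ?_⟩
    · rintro ⟨z, h1, h2⟩
      exact ⟨⟨z, hE.trans u.2 (H.subset _ h1)⟩, h1, h2⟩
    · rintro ⟨z, h1, h2⟩
      exact ⟨z.1, h1, h2⟩
  · intro b
    ext ⟨u, w⟩
    have := key (.conv (.var (idx b)), .var (idx (RelAlg.conv b)))
      (by simp [diagramList, hidx.eq_iff]) u w
    simp only [RelTerm.eval, H.map_conv] at this
    exact this.symm
  · ext ⟨u, w⟩
    have := key (.ident, .var (idx RelAlg.ident)) (by simp [diagramList, hidx.eq_iff]) u w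
    simp only [RelTerm.eval, H.map_ident] at this
    exact this.symm.trans Subtype.ext_iff.symm

lemma RRA_of_satisfiesUpTo {A : Type} [RelAlg A] [Finite A] {m : ℕ} (hm : Nat.card A ≤ m)
    (hA : SatisfiesUpTo RRA (sufficientLength m) A) : RRA A := by
  classical
  have := Fintype.ofFinite A
  rw [Nat.card_eq_fintype_card] at hm
  -- `A` obeys no laws a priori; the summand 20 of `sufficientLength` leaves room for the few
  -- identities needed below.
  have h20 : ∀ e : RelEquation, e.length ≤ 20 → e.TrueIn RRA → e.Holds A :=
    fun e he => hA e (he.trans (by unfold sufficientLength; omega))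
  have xmul : ∀ a b : A, a = RelAlg.add (RelAlg.mul a b) (RelAlg.mul a (RelAlg.compl b)) := by
    intro a b
    refine h20 ⟨.var 0, .add (.mul (.var 0) (.var 1)) (.mul (.var 0) (.compl (.var 1)))⟩
      (by decide) (RelEquation.trueIn_RRA fun B U _ E h H v => ?_) (fun i => if i = 0 then a else b)
    simp only [RelTerm.eval, H.map_add, H.map_mul, H.map_compl]
    ext p
    have := @H.subset (v 0) p
    simp only [Set.mem_union, Set.mem_inter_iff, Set.mem_sdiff]
    tauto
  have ymul : ∀ a b : A, b = RelAlg.add (RelAlg.mul a b) (RelAlg.mul (RelAlg.compl a) b) := by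
    intro a b
    refine h20 ⟨.var 1, .add (.mul (.var 0) (.var 1)) (.mul (.compl (.var 0)) (.var 1))⟩
      (by decide) (RelEquation.trueIn_RRA fun B U _ E h H v => ?_) (fun i => if i = 0 then a else b)
    simp only [RelTerm.eval, H.map_add, H.map_mul, H.map_compl]
    ext p
    have := @H.subset (v 1) p
    simp only [Set.mem_union, Set.mem_inter_iff, Set.mem_sdiff]
    tauto
  have hsymm : ∀ a : A, RelAlg.add (RelAlg.add (RelAlg.mul a (RelAlg.compl a))
      (RelAlg.mul (RelAlg.compl a) a)) RelAlg.zero = RelAlg.zero := by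
    intro a
    refine h20 ⟨.add (RelTerm.symmDiff (.var 0) (.var 0)) .zero, .zero⟩
      (by decide) (RelEquation.trueIn_RRA fun B U _ E h H v => ?_) (fun i => a)
    simp only [RelTerm.symmDiff, RelTerm.eval, H.map_add, H.map_mul, H.map_compl, H.map_zero]
    ext p
    simp only [Set.mem_union, Set.mem_inter_iff, Set.mem_sdiff, Set.mem_empty_iff_false]
    tauto
  have hcomp : ∀ a : A, RelAlg.mul a (RelAlg.comp RelAlg.one
      (RelAlg.comp RelAlg.zero RelAlg.one)) = RelAlg.zero := by
    intro a
    refine h20 ⟨.mul (.var 0) (.comp .one (.comp .zero .one)), .zero⟩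
      (by decide) (RelEquation.trueIn_RRA fun B U _ E h H v => ?_) (fun i => a)
    simp [RelTerm.eval, H.map_mul, H.map_comp, H.map_zero]
  obtain ⟨idx, hidx⟩ := Countable.exists_injective_nat A
  have : Nonempty A := ⟨RelAlg.zero⟩
  have hv : ∀ a, Function.invFun idx (idx a) = a := Function.leftInverse_invFun hidx
  have hτ : ∀ l : List (RelTerm × RelTerm),
      (∀ p ∈ l, p.1.eval (Function.invFun idx) = p.2.eval (Function.invFun idx)) →
      (RelTerm.sumSymmDiff l).eval (Function.invFun idx) = RelAlg.zero := by
    intro l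
    induction l with
    | nil => exact fun _ => rfl
    | cons p l ih =>
      intro hl
      simp only [RelTerm.sumSymmDiff, RelTerm.symmDiff, RelTerm.eval]
      rw [hl p (by simp), ih fun q hq => hl q (by simp [hq])]
      exact hsymm _
  refine RRA_of_squareHoms (fun a b h1 h2 => ?_) fun a ha => ?_
  · rw [xmul a b, h1, ← h2]
    exact (ymul a b).symm
  · refine exists_squareHom_of_not_trueIn hidx fun htrue => ha ?_
    have hlen : (diagramEquation A idx a).length ≤ sufficientLength m := by
      have h1 := RelTerm.sumSymmDiff_length (diagramList A idx)
        fun p hp => length_le_of_mem_diagramList hp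
      rw [diagramList_length] at h1
      have h2 : Fintype.card A ^ 2 ≤ m ^ 2 := Nat.pow_le_pow_left hm 2
      simp only [diagramEquation, RelEquation.length, RelTerm.length, sufficientLength]
      omega
    -- Under the naming assignment `τ` is zero, so the equation would force `a` to be zero.
    have h3 := hA _ hlen htrue (Function.invFun idx)
    simp only [diagramEquation, RelTerm.eval, hv] at h3
    rw [hτ _ fun p hp => eval_of_mem_diagramList hv hp, hcomp] at h3
    exact h3.symm

lemma satisfiesUpTo_of_RRA {A : Type} [RelAlg A] (hA : RRA A) (N : ℕ) : SatisfiesUpTo RRA N A :=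
  fun _ _ he => he A hA

lemma sufficientLength_mem_complexityBounds (m : ℕ) :
    sufficientLength m ∈ complexityBounds RRA m := fun _ _ _ hm =>
  ⟨fun hA => satisfiesUpTo_of_RRA hA _, RRA_of_satisfiesUpTo hm⟩

lemma isLeast_eqComplexity (m : ℕ) : IsLeast (complexityBounds RRA m) (eqComplexity RRA m) :=
  ⟨Nat.sInf_mem ⟨_, sufficientLength_mem_complexityBounds m⟩, fun _ hN => Nat.sInf_le hN⟩

/-! ### Lyndon algebras are relation algebras -/

/-- The cycles of the Lyndon algebra of a set `P` of points: `none` stands for the identity atom,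
and three points form a cycle if they are all equal or all distinct. -/
def LyndonCycle {P : Type} : Option P → Option P → Option P → Prop
  | none, b, c => b = c
  | some a, none, c => c = some a
  | some a, some b, none => a = b
  | some a, some b, some c => (a = b ∧ b = c) ∨ (a ≠ b ∧ b ≠ c ∧ a ≠ c)

/-- The Lyndon algebra of a set `P` of points (the points of a projective line): the complex
algebra over the atoms `Option P`. -/
instance lyndonRelAlg (P : Type) : RelAlg (Set (Option P)) where
  add X Y := X ∪ Y
  mul X Y := X ∩ Y
  compl X := Xᶜ
  zero := ∅
  one := Set.univ
  comp X Y := {c | ∃ a ∈ X, ∃ b ∈ Y, LyndonCycle a b c}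
  conv X := X
  ident := {none}

lemma LyndonCycle.swap {P : Type} {a b c : Option P} (h : LyndonCycle a b c) :
    LyndonCycle b a c := by
  rcases a with _ | a <;> rcases b with _ | b <;> rcases c with _ | c <;>
    grind [LyndonCycle]

lemma LyndonCycle.rotate {P : Type} {a b c : Option P} (h : LyndonCycle a b c) :
    LyndonCycle a c b := by
  rcases a with _ | a <;> rcases b with _ | b <;> rcases c with _ | c <;>
    grind [LyndonCycle]

/-- A fifth point `e` is the intermediate point when `b ≠ c` and `a ≠ d`; in the other cases one of
the given atoms or the identity serves. -/
lemma LyndonCycle.assoc {P : Type} (hP : ∀ a b c d : P, ∃ e, e ≠ a ∧ e ≠ b ∧ e ≠ c ∧ e ≠ d)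
    {a b c d x : Option P} (h1 : LyndonCycle a b x) (h2 : LyndonCycle x c d) :
    ∃ y, LyndonCycle b c y ∧ LyndonCycle a y d := by
  rcases a with _ | a
  · rw [show b = x from h1]
    exact ⟨d, h2, rfl⟩
  rcases b with _ | b
  · rw [show x = some a from h1] at h2
    exact ⟨c, rfl, h2⟩
  rcases c with _ | c
  · refine ⟨some b, rfl, ?_⟩
    rcases x with _ | x
    · rw [show none = d from h2] at h1; exact h1
    · rw [show d = some x from h2]; exact h1
  rcases d with _ | d
  · refine ⟨some a, ?_, rfl⟩
    rcases x with _ | x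
    · have e1 : a = b := h1
      have e2 : some c = none := h2
      cases e2
    · have e2 : x = c := h2
      rw [e2] at h1
      exact h1.rotate.swap.rotate.swap
  obtain ⟨e, he1, he2, he3, he4⟩ := hP a b c d
  by_cases hbc : b = c
  · by_cases had : a = d
    · exact ⟨none, hbc, congrArg some had.symm⟩
    · refine ⟨some b, Or.inl ⟨hbc, hbc.symm⟩, ?_⟩
      rcases x with _ | x <;> simp only [LyndonCycle, Option.some.injEq] at * <;> grind
  · by_cases had : a = d
    · refine ⟨some a, ?_, Or.inl ⟨rfl, had⟩⟩
      rcases x with _ | x <;> simp only [LyndonCycle, Option.some.injEq] at * <;> grind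
    · refine ⟨some e, Or.inr ?_, Or.inr ?_⟩ <;> grind

lemma lyndon_isRelationAlgebra {P : Type}
    (hP : ∀ a b c d : P, ∃ e, e ≠ a ∧ e ≠ b ∧ e ≠ c ∧ e ≠ d) :
    IsRelationAlgebra (Set (Option P)) where
  add_comm := Set.union_comm
  mul_comm := Set.inter_comm
  add_mul_distrib := Set.union_inter_distrib_left
  mul_add_distrib := Set.inter_union_distrib_left
  add_zero := Set.union_empty
  mul_one := Set.inter_univ
  add_compl := Set.union_compl_self
  mul_compl := Set.inter_compl_self
  comp_assoc X Y Z := by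
    ext d
    constructor
    · rintro ⟨x, ⟨a, ha, b, hb, h1⟩, c, hc, h2⟩
      obtain ⟨y, h3, h4⟩ := LyndonCycle.assoc hP h1 h2
      exact ⟨a, ha, y, ⟨b, hb, c, hc, h3⟩, h4⟩
    · rintro ⟨a, ha, y, ⟨b, hb, c, hc, h1⟩, h2⟩
      obtain ⟨x, h3, h4⟩ := LyndonCycle.assoc hP h1.swap h2.swap
      exact ⟨x, ⟨a, ha, b, hb, h3.swap⟩, c, hc, h4.swap⟩
  add_comp X Y Z := by
    ext d
    constructor
    · rintro ⟨a, ha | ha, b, hb, h⟩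
      · exact Or.inl ⟨a, ha, b, hb, h⟩
      · exact Or.inr ⟨a, ha, b, hb, h⟩
    · rintro (⟨a, ha, b, hb, h⟩ | ⟨a, ha, b, hb, h⟩)
      · exact ⟨a, Or.inl ha, b, hb, h⟩
      · exact ⟨a, Or.inr ha, b, hb, h⟩
  comp_ident X := by
    ext d
    constructor
    · rintro ⟨a, ha, b, rfl, h⟩
      rw [show a = d from h.swap] at ha
      exact ha
    · exact fun hd => ⟨d, hd, none, rfl, LyndonCycle.swap rfl⟩
  conv_conv _ := rfl
  conv_add _ _ := rfl
  conv_comp X Y := by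
    ext d
    constructor
    · rintro ⟨a, ha, b, hb, h⟩
      exact ⟨b, hb, a, ha, h.swap⟩
    · rintro ⟨a, ha, b, hb, h⟩
      exact ⟨b, hb, a, ha, h.swap⟩
  tarski X Y := by
    refine Set.union_eq_right.2 ?_
    rintro d ⟨a, ha, b, hb, h⟩ hd
    exact hb ⟨a, ha, d, hd, h.rotate⟩

lemma lyndon_relAtoms_ncard_le (P : Type) [Finite P] :
    (relAtoms (Set (Option P))).ncard ≤ Nat.card P + 1 := by
  have hsub : relAtoms (Set (Option P)) ⊆ Set.range fun x : Option P => ({x} : Set (Option P)) := by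
    rintro X ⟨hX0, hX⟩
    obtain ⟨x, hx⟩ := Set.nonempty_iff_ne_empty.2 hX0
    refine ⟨x, (hX {x} (Set.inter_eq_left.2 (Set.singleton_subset_iff.2 hx))).resolve_left ?_⟩
    exact Set.singleton_ne_empty x
  refine (Set.ncard_le_ncard hsub (Set.finite_range _)).trans ?_
  rw [← Set.image_univ]
  refine (Set.ncard_image_le Set.finite_univ).trans ?_
  rw [Set.ncard_univ, Finite.card_option]

/-! ### Direction maps, and the rational plane as a representation -/

/-- A map that assigns to every pair of elements of `U` an atom of the Lyndon algebra of `P`, in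
the way in which pairs of points of an affine plane determine directions. -/
structure IsDirectionMap {U P : Type} (dir : U → U → Option P) : Prop where
  eq_none_iff : ∀ x y, dir x y = none ↔ x = y
  symm : ∀ x y, dir x y = dir y x
  cycle : ∀ x z y, LyndonCycle (dir x z) (dir z y) (dir x y)
  exists_of_cycle : ∀ x y a b, LyndonCycle a b (dir x y) → ∃ z, dir x z = a ∧ dir z y = b

lemma IsDirectionMap.lyndon_RRA {U P : Type} {dir : U → U → Option P} (H : IsDirectionMap dir)
    (hsurj : ∀ a, ∃ x y, dir x y = a) : RRA (Set (Option P)) := by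
  refine ⟨U, Set.univ, fun X => {p | dir p.1 p.2 ∈ X},
    ⟨⟨fun _ => trivial, fun _ => trivial, fun _ _ => trivial⟩, ?_, fun _ => Set.subset_univ _,
      fun _ _ => rfl, fun _ _ => rfl, fun X => ?_, rfl, rfl, fun X Y => ?_, fun X => ?_, ?_⟩⟩
  · intro X Y hXY
    ext a
    obtain ⟨x, y, rfl⟩ := hsurj a
    exact Set.ext_iff.1 hXY (x, y)
  · ext p
    exact ⟨fun hp => ⟨trivial, hp⟩, fun hp => hp.2⟩
  · ext p
    constructor
    · rintro ⟨a, ha, b, hb, h⟩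
      obtain ⟨z, rfl, rfl⟩ := H.exists_of_cycle _ _ _ _ h
      exact ⟨z, ha, hb⟩
    · rintro ⟨z, ha, hb⟩
      exact ⟨_, ha, _, hb, H.cycle _ _ _⟩
  · ext p
    exact iff_of_eq (congrArg (· ∈ X) (H.symm p.1 p.2))
  · ext p
    exact H.eq_none_iff p.1 p.2

/-- The linear form on `ℚ × ℚ` whose kernel is the line through the origin of slope `p`, where
`none` is the vertical slope. -/
def slopeForm : Option ℚ → ℚ × ℚ → ℚ
  | none, u => u.1
  | some m, u => u.2 - m * u.1

lemma slopeForm_sub (p : Option ℚ) (u w : ℚ × ℚ) :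
    slopeForm p (u - w) = slopeForm p u - slopeForm p w := by
  cases p <;> simp [slopeForm]; ring

lemma slopeForm_neg (p : Option ℚ) (u : ℚ × ℚ) : slopeForm p (-u) = -slopeForm p u := by
  cases p <;> simp [slopeForm]; ring

lemma slopeForm_smul (p : Option ℚ) (c : ℚ) (u : ℚ × ℚ) :
    slopeForm p (c • u) = c * slopeForm p u := by
  cases p <;> simp [slopeForm]; ring

lemma slopeForm_zero (p : Option ℚ) : slopeForm p 0 = 0 := by
  cases p <;> simp [slopeForm]

lemma eq_of_slopeForm_eq_zero {p r : Option ℚ} {u : ℚ × ℚ} (hu : u ≠ 0)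
    (hp : slopeForm p u = 0) (hr : slopeForm r u = 0) : p = r := by
  obtain ⟨a, b⟩ := u
  rcases p with _ | m <;> rcases r with _ | k <;> simp only [slopeForm] at hp hr
  · rfl
  · exact absurd (by simp_all) hu
  · exact absurd (by simp_all) hu
  · have h0 : (m - k) * a = 0 := by linear_combination hr - hp
    rcases mul_eq_zero.1 h0 with h | h
    · rw [sub_eq_zero.1 h]
    · exact absurd (by simp_all) hu

lemma exists_slopeForm_eq {p r : Option ℚ} (hpr : p ≠ r) (c : ℚ) :
    ∃ u, slopeForm p u = 0 ∧ slopeForm r u = c := by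
  rcases p with _ | m <;> rcases r with _ | k <;> simp only [slopeForm]
  · exact absurd rfl hpr
  · exact ⟨(0, c), by simp⟩
  · exact ⟨(c, m * c), by simp⟩
  · have h : m - k ≠ 0 := fun h => hpr (by rw [sub_eq_zero.1 h])
    exact ⟨(c / (m - k), m * (c / (m - k))), by simp, by simp; field_simp⟩

lemma exists_slopeForm_eq_zero {u : ℚ × ℚ} (_ : u ≠ 0) : ∃ p, slopeForm p u = 0 := by
  by_cases h : u.1 = 0
  · exact ⟨none, h⟩
  · exact ⟨some (u.2 / u.1), by simp only [slopeForm]; field_simp; ring⟩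

open Classical in
/-- The slope of a vector of the rational plane; `none` for the zero vector. -/
noncomputable def slopeOf (u : ℚ × ℚ) : Option (Option ℚ) :=
  if hu : u = 0 then none else some (exists_slopeForm_eq_zero hu).choose

lemma slopeOf_eq_none {u : ℚ × ℚ} : slopeOf u = none ↔ u = 0 := by
  unfold slopeOf; split_ifs with h <;> simp [h]

lemma slopeOf_eq_some {u : ℚ × ℚ} {p : Option ℚ} :
    slopeOf u = some p ↔ u ≠ 0 ∧ slopeForm p u = 0 := by
  unfold slopeOf
  split_ifs with h
  · simp [h]
  · have hs := (exists_slopeForm_eq_zero h).choose_spec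
    simp only [Option.some.injEq]
    exact ⟨fun e => ⟨h, e ▸ hs⟩, fun e => eq_of_slopeForm_eq_zero h hs e.2⟩

lemma slopeOf_neg (u : ℚ × ℚ) : slopeOf (-u) = slopeOf u := by
  rcases h : slopeOf u with _ | p
  · rw [slopeOf_eq_none] at h ⊢; simpa using h
  · rw [slopeOf_eq_some] at h ⊢; simpa [slopeForm_neg] using h

/-- A nondegenerate triangle has three distinct slopes, a degenerate one three equal slopes;
conversely lines of different slopes meet, and a segment has an interior point. -/
lemma isDirectionMap_slope : IsDirectionMap fun x y : ℚ × ℚ => slopeOf (y - x) where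
  eq_none_iff x y := by rw [slopeOf_eq_none, sub_eq_zero, eq_comm]
  symm x y := by rw [← slopeOf_neg, neg_sub]
  cycle x z y := by
    have hsum : y - x = (z - x) - -(y - z) := by abel
    generalize z - x = u at *
    rw [hsum, ← slopeOf_neg (y - z)]
    generalize -(y - z) = w
    rcases hu : slopeOf u with _ | p
    · rw [slopeOf_eq_none.1 hu, zero_sub, slopeOf_neg]; rfl
    rcases hw : slopeOf w with _ | r
    · rw [slopeOf_eq_none.1 hw, sub_zero]; exact hu
    rcases hs : slopeOf (u - w) with _ | s
    · rw [sub_eq_zero.1 (slopeOf_eq_none.1 hs), hw] at hu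
      exact (Option.some.inj hu).symm
    rw [slopeOf_eq_some] at hu hw hs
    rw [slopeForm_sub] at hs
    by_cases hpr : p = r
    · subst hpr
      exact Or.inl ⟨rfl, eq_of_slopeForm_eq_zero hs.1
        (by rw [slopeForm_sub, hu.2, hw.2, sub_zero]) (by rw [slopeForm_sub, hs.2])⟩
    · refine Or.inr ⟨hpr, ?_, ?_⟩
      · rintro rfl
        exact hpr (eq_of_slopeForm_eq_zero hu.1 hu.2 (by linarith [hs.2, hw.2]))
      · rintro rfl
        exact hpr (eq_of_slopeForm_eq_zero hw.1 (by linarith [hs.2, hu.2]) hw.2)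
  exists_of_cycle x y a b h := by
    suffices hw : ∃ w, slopeOf w = a ∧ slopeOf (y - x - w) = b by
      obtain ⟨w, h1, h2⟩ := hw
      refine ⟨x + w, by simpa using h1, ?_⟩
      rw [← h2]
      congr 1
      abel
    generalize y - x = u at h
    rcases a with _ | p
    · exact ⟨0, slopeOf_eq_none.2 rfl, by rw [sub_zero]; exact h.symm⟩
    rcases b with _ | r
    · exact ⟨u, h, by rw [sub_self]; exact slopeOf_eq_none.2 rfl⟩
    rcases hs : slopeOf u with _ | s
    · rw [hs] at h
      obtain rfl : p = r := h
      obtain ⟨q, hq⟩ : ∃ q, p ≠ q := by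
        rcases p with _ | m
        · exact ⟨some 0, by simp⟩
        · exact ⟨none, by simp⟩
      obtain ⟨w, h1, h2⟩ := exists_slopeForm_eq hq 1
      have hw : slopeOf w = some p := by
        refine slopeOf_eq_some.2 ⟨?_, h1⟩
        rintro rfl
        rw [slopeForm_zero] at h2
        exact zero_ne_one h2
      refine ⟨w, hw, ?_⟩
      rw [slopeOf_eq_none.1 hs, zero_sub, slopeOf_neg, hw]
    · rw [hs] at h
      rw [slopeOf_eq_some] at hs
      rcases h with ⟨rfl, rfl⟩ | ⟨h1, h2, h3⟩
      -- For the cycle `p, p, p` the intermediate point is the midpoint, distinct from both ends.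
      · have hhalf : slopeOf ((1 / 2 : ℚ) • u) = some p := by
          refine slopeOf_eq_some.2 ⟨smul_ne_zero (by norm_num) hs.1, ?_⟩
          rw [slopeForm_smul, hs.2, mul_zero]
        refine ⟨(1 / 2 : ℚ) • u, hhalf, ?_⟩
        rw [← hhalf]
        congr 1
        module
      -- Here `w` is where the line of slope `p` through `0` meets the line of slope `r` through
      -- `u`.
      · obtain ⟨w, hw1, hw2⟩ := exists_slopeForm_eq h1 (slopeForm r u)
        refine ⟨w, slopeOf_eq_some.2 ⟨?_, hw1⟩, slopeOf_eq_some.2 ⟨?_, ?_⟩⟩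
        · rintro rfl
          rw [slopeForm_zero] at hw2
          exact h2 (eq_of_slopeForm_eq_zero hs.1 hw2.symm hs.2)
        · intro h0
          rw [← sub_eq_zero.1 h0] at hw1
          exact h3 (eq_of_slopeForm_eq_zero hs.1 hw1 hs.2)
        · rw [slopeForm_sub, hw2, sub_self]

lemma lyndon_optionRat_RRA : RRA (Set (Option (Option ℚ))) := by
  refine isDirectionMap_slope.lyndon_RRA fun a => ?_
  have h := isDirectionMap_slope.exists_of_cycle 0 0 a a (by
    simp only [sub_self, slopeOf_eq_none.2]
    cases a <;> simp [LyndonCycle])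
  obtain ⟨z, hz, -⟩ := h
  exact ⟨0, z, hz⟩

/-! ### Equations with few variables hold in finite Lyndon algebras -/

/-- The variables that occur in a term. -/
def RelTerm.vars : RelTerm → Finset ℕ
  | .var i => {i}
  | .add s t => s.vars ∪ t.vars
  | .mul s t => s.vars ∪ t.vars
  | .compl t => t.vars
  | .zero => ∅
  | .one => ∅
  | .comp s t => s.vars ∪ t.vars
  | .conv t => t.vars
  | .ident => ∅

/-- Joining `k` occurrences of variables takes at least `k - 1` binary symbols. -/
lemma RelTerm.two_mul_card_vars_le (t : RelTerm) : 2 * t.vars.card ≤ t.length + 1 := by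
  induction t with
  | add s t hs ht =>
    have := Finset.card_union_le s.vars t.vars
    simp only [vars, length]; omega
  | mul s t hs ht =>
    have := Finset.card_union_le s.vars t.vars
    simp only [vars, length]; omega
  | comp s t hs ht =>
    have := Finset.card_union_le s.vars t.vars
    simp only [vars, length]; omega
  | compl t ht => simp only [vars, length]; omega
  | conv t ht => simp only [vars, length]; omega
  | _ => simp [vars, length]

/-- The variables that occur in an equation. -/
def RelEquation.vars (e : RelEquation) : Finset ℕ := e.lhs.vars ∪ e.rhs.vars

lemma RelEquation.two_mul_card_vars_le (e : RelEquation) : 2 * e.vars.card ≤ e.length + 2 := by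
  have h1 := e.lhs.two_mul_card_vars_le
  have h2 := e.rhs.two_mul_card_vars_le
  have h3 := Finset.card_union_le e.lhs.vars e.rhs.vars
  unfold vars length
  omega

/-- A set of atoms that does not separate the points `p` and `r`. -/
def NonSeparating {P : Type} (p r : P) (X : Set (Option P)) : Prop := some p ∈ X ↔ some r ∈ X

lemma LyndonCycle.map_iff {P Q : Type} {f : P → Q} (hf : Function.Injective f) {a b c : Option P} :
    LyndonCycle (a.map f) (b.map f) (c.map f) ↔ LyndonCycle a b c := by
  cases a <;> cases b <;> cases c <;> simp [LyndonCycle, hf.eq_iff, hf.ne_iff]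

/-- The transposition of `p` and `r` preserves cycles, and a set is nonseparating exactly when this
transposition maps it into itself. -/
lemma NonSeparating.comp {P : Type} {p r : P} {X Y : Set (Option P)}
    (hX : NonSeparating p r X) (hY : NonSeparating p r Y) :
    NonSeparating p r (RelAlg.comp X Y) := by
  classical
  have hσ : ∀ Z : Set (Option P), NonSeparating p r Z →
      ∀ a ∈ Z, a.map (Equiv.swap p r) ∈ Z := by
    rintro Z hZ (_ | a) ha
    · exact ha
    · simp only [Option.map_some]
      rcases eq_or_ne a p with rfl | h1
      · rw [Equiv.swap_apply_left]; exact hZ.1 ha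
      rcases eq_or_ne a r with rfl | h2
      · rw [Equiv.swap_apply_right]; exact hZ.2 ha
      · rwa [Equiv.swap_apply_of_ne_of_ne h1 h2]
  have key : ∀ c ∈ (RelAlg.comp X Y : Set (Option P)),
      c.map (Equiv.swap p r) ∈ (RelAlg.comp X Y : Set (Option P)) := by
    rintro c ⟨a, ha, b, hb, h⟩
    exact ⟨_, hσ X hX a ha, _, hσ Y hY b hb,
      (LyndonCycle.map_iff (Equiv.swap p r).injective).2 h⟩
  constructor
  · intro h
    simpa using key _ h
  · intro h
    simpa using key _ h

lemma NonSeparating.eval {P : Type} {p r : P} {v : ℕ → Set (Option P)} {t : RelTerm}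
    (hv : ∀ i ∈ t.vars, NonSeparating p r (v i)) : NonSeparating p r (t.eval v) := by
  induction t with
  | var i => exact hv i (by simp [RelTerm.vars])
  | add s t hs ht =>
    exact or_congr (hs fun i hi => hv i (Finset.mem_union_left _ hi))
      (ht fun i hi => hv i (Finset.mem_union_right _ hi))
  | mul s t hs ht =>
    exact and_congr (hs fun i hi => hv i (Finset.mem_union_left _ hi))
      (ht fun i hi => hv i (Finset.mem_union_right _ hi))
  | compl t ht => exact not_congr (ht hv)
  | zero => exact Iff.rfl
  | one => exact Iff.rfl
  | comp s t hs ht =>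
    exact (hs fun i hi => hv i (Finset.mem_union_left _ hi)).comp
      (ht fun i hi => hv i (Finset.mem_union_right _ hi))
  | conv t ht => exact ht hv
  | ident => simp [NonSeparating, RelTerm.eval, RelAlg.ident]

/-- Cycles of `P` lift to cycles of `Q`. A cycle of distinct points of `Q` may lose distinctness
under `π`, but only by a collision at `p`; since the sets do not separate `p` from `r`, exchanging
these two points where necessary restores a cycle of `P`. -/
lemma preimage_comp_of_nonSeparating {P Q : Type} {π : Q → P} {p r : P} (hpr : p ≠ r)
    (hsurj : Function.Surjective π) (hπ : ∀ x y, π x = π y → x = y ∨ π x = p)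
    {X Y : Set (Option P)} (hX : NonSeparating p r X) (hY : NonSeparating p r Y) :
    Option.map π ⁻¹' (RelAlg.comp X Y : Set (Option P)) =
      (RelAlg.comp (Option.map π ⁻¹' X) (Option.map π ⁻¹' Y) : Set (Option Q)) := by
  ext c
  constructor
  · rintro ⟨a, ha, b, hb, h⟩
    rcases a with _ | a
    · rw [show b = c.map π from h] at hb
      exact ⟨none, ha, c, hb, rfl⟩
    rcases b with _ | b
    · rw [← show c.map π = some a from h] at ha
      exact ⟨c, ha, none, hb, LyndonCycle.swap rfl⟩
    obtain ⟨a, rfl⟩ := hsurj a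
    obtain ⟨b, rfl⟩ := hsurj b
    rcases c with _ | c
    · rw [← show π a = π b from h] at hb
      exact ⟨some a, ha, some a, hb, rfl⟩
    rcases h with ⟨h1, h2⟩ | ⟨h1, h2, h3⟩
    · refine ⟨some c, ?_, some c, ?_, Or.inl ⟨rfl, rfl⟩⟩
      · rwa [h1, h2] at ha
      · rwa [h2] at hb
    · exact ⟨some a, ha, some b, hb,
        Or.inr ⟨ne_of_apply_ne π h1, ne_of_apply_ne π h2, ne_of_apply_ne π h3⟩⟩
  · rintro ⟨a, ha, b, hb, h⟩
    rcases a with _ | a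
    · rw [show b = c from h] at hb
      exact ⟨none, ha, _, hb, rfl⟩
    rcases b with _ | b
    · rw [← show c = some a from h] at ha
      exact ⟨_, ha, none, hb, LyndonCycle.swap rfl⟩
    rcases c with _ | c
    · rw [show a = b from h] at ha
      exact ⟨_, ha, _, hb, rfl⟩
    rcases h with ⟨rfl, rfl⟩ | ⟨h1, h2, h3⟩
    · exact ⟨_, ha, _, hb, Or.inl ⟨rfl, rfl⟩⟩
    have ha' : some (π a) ∈ X := ha
    have hb' : some (π b) ∈ Y := hb
    change some (π c) ∈ (RelAlg.comp X Y : Set (Option P))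
    by_cases hab : π a = π b
    · have hp := (hπ _ _ hab).resolve_left h1
      rw [← hab] at hb'
      rw [hp] at ha' hb'
      by_cases hcr : π c = r
      · rw [hcr]
        exact ⟨_, hX.1 ha', _, hY.1 hb', Or.inl ⟨rfl, rfl⟩⟩
      by_cases hcp : π c = p
      · rw [hcp]
        exact ⟨_, ha', _, hb', Or.inl ⟨rfl, rfl⟩⟩
      · exact ⟨_, ha', _, hY.1 hb', Or.inr ⟨hpr, Ne.symm hcr, Ne.symm hcp⟩⟩
    by_cases hbc : π b = π c
    · have hp := (hπ _ _ hbc).resolve_left h2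
      rw [← hbc, hp]
      rw [hp] at hb' hab
      by_cases har : π a = r
      · exact ⟨_, hX.2 (har ▸ ha'), _, hb', Or.inl ⟨rfl, rfl⟩⟩
      · exact ⟨_, ha', _, hY.1 hb', Or.inr ⟨har, hpr.symm, hab⟩⟩
    by_cases hac : π a = π c
    · have hp := (hπ _ _ hac).resolve_left h3
      rw [← hac, hp]
      rw [hp] at ha' hab
      by_cases hbr : π b = r
      · exact ⟨_, ha', _, hY.2 (hbr ▸ hb'), Or.inl ⟨rfl, rfl⟩⟩
      · exact ⟨_, hX.1 ha', _, hb', Or.inr ⟨Ne.symm hbr, Ne.symm hab, hpr.symm⟩⟩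
    · exact ⟨_, ha', _, hb', Or.inr ⟨hab, hbc, hac⟩⟩

lemma eval_preimage_of_nonSeparating {P Q : Type} {π : Q → P} {p r : P} (hpr : p ≠ r)
    (hsurj : Function.Surjective π) (hπ : ∀ x y, π x = π y → x = y ∨ π x = p)
    {v : ℕ → Set (Option P)} {t : RelTerm} (hv : ∀ i ∈ t.vars, NonSeparating p r (v i)) :
    t.eval (fun i => Option.map π ⁻¹' v i) = Option.map π ⁻¹' t.eval v := by
  induction t with
  | var i => rfl
  | add s t hs ht =>
    exact congrArg₂ (· ∪ ·) (hs fun i hi => hv i (Finset.mem_union_left _ hi))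
      (ht fun i hi => hv i (Finset.mem_union_right _ hi))
  | mul s t hs ht =>
    exact congrArg₂ (· ∩ ·) (hs fun i hi => hv i (Finset.mem_union_left _ hi))
      (ht fun i hi => hv i (Finset.mem_union_right _ hi))
  | compl t ht => exact congrArg (·ᶜ) (ht hv)
  | zero => rfl
  | one => rfl
  | comp s t hs ht =>
    have hs' : ∀ i ∈ s.vars, NonSeparating p r (v i) :=
      fun i hi => hv i (Finset.mem_union_left _ hi)
    have ht' : ∀ i ∈ t.vars, NonSeparating p r (v i) :=
      fun i hi => hv i (Finset.mem_union_right _ hi)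
    simp only [RelTerm.eval]
    rw [preimage_comp_of_nonSeparating hpr hsurj hπ (.eval hs') (.eval ht'), hs hs', ht ht']
  | conv t ht => exact ht hv
  | ident =>
    ext c
    cases c <;> simp [RelTerm.eval, RelAlg.ident]

lemma exists_collapse {P Q : Type} [Finite P] [Infinite Q] (p : P) :
    ∃ π : Q → P, Function.Surjective π ∧ ∀ x y, π x = π y → x = y ∨ π x = p := by
  classical
  have := Fintype.ofFinite P
  obtain ⟨f⟩ : Nonempty (P ↪ Q) := ⟨(Fintype.equivFin P).toEmbedding.trans
    (Fin.valEmbedding.trans (Infinite.natEmbedding Q))⟩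
  -- A copy of `P` inside `Q` is mapped back identically; all remaining points go to `p`.
  refine ⟨Function.extend f id fun _ => p, fun a => ⟨f a, f.injective.extend_apply _ _ _⟩, ?_⟩
  intro x y hxy
  by_cases hx : ∃ a, f a = x
  · by_cases hy : ∃ a, f a = y
    · obtain ⟨a, rfl⟩ := hx
      obtain ⟨b, rfl⟩ := hy
      rw [f.injective.extend_apply, f.injective.extend_apply] at hxy
      exact Or.inl (congrArg f hxy)
    · right
      rw [hxy, Function.extend_apply' _ _ _ hy]
  · right
    rw [Function.extend_apply' _ _ _ hx]

/-- A finite Lyndon algebra satisfies the equations true in `RRA` that have so few variables that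
every assignment fails to separate some two points. -/
lemma lyndon_holds_of_card_vars {P : Type} [Finite P] {e : RelEquation}
    (hcard : 2 ^ e.vars.card < Nat.card P) (he : e.TrueIn RRA) : e.Holds (Set (Option P)) := by
  classical
  have := Fintype.ofFinite P
  intro v
  -- Pigeonhole on the set of variables whose value contains a given point.
  obtain ⟨p, r, hpr, hcol⟩ := Fintype.exists_ne_map_eq_of_card_lt
    (fun (a : P) (i : e.vars) => decide (some a ∈ v i)) (by
      rw [Fintype.card_fun, Fintype.card_bool, Fintype.card_coe, ← Nat.card_eq_fintype_card]
      exact hcard)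
  have hv : ∀ i ∈ e.vars, NonSeparating p r (v i) := fun i hi => by
    simpa [NonSeparating] using congrFun hcol ⟨i, hi⟩
  obtain ⟨π, hsurj, hπ⟩ := exists_collapse (Q := Option ℚ) p
  have h := he _ lyndon_optionRat_RRA fun i => Option.map π ⁻¹' v i
  rw [eval_preimage_of_nonSeparating hpr hsurj hπ fun i hi => hv i (Finset.mem_union_left _ hi),
    eval_preimage_of_nonSeparating hpr hsurj hπ fun i hi => hv i (Finset.mem_union_right _ hi)] at h
  have hmap : Function.Surjective (Option.map π) := by
    rintro (_ | a)
    · exact ⟨none, rfl⟩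
    · obtain ⟨b, rfl⟩ := hsurj a
      exact ⟨some b, rfl⟩
  exact hmap.preimage_injective h

lemma lyndon_satisfiesUpTo {P : Type} [Finite P] {N : ℕ}
    (hN : 2 ^ ((N + 2) / 2) < Nat.card P) : SatisfiesUpTo RRA N (Set (Option P)) := by
  intro e he htrue
  refine lyndon_holds_of_card_vars (lt_of_le_of_lt (Nat.pow_le_pow_right (by norm_num) ?_) hN) htrue
  have := e.two_mul_card_vars_le
  omega

/-! ### Bruck–Ryser: quadratic forms over `ℚ` -/

/-- Every square matrix becomes nonsingular after subtracting a suitable diagonal matrix of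
signs. -/
lemma exists_signs_injective {ι : Type} [Fintype ι] (A : (ι → ℚ) →ₗ[ℚ] (ι → ℚ)) :
    ∃ ε : ι → ℚ, (∀ j, ε j ^ 2 = 1) ∧ ∀ y, (∀ j, A y j = ε j * y j) → y = 0 := by
  classical
  -- Induction over principal submatrices, expressed by vectors supported on `s`.
  suffices h : ∀ s : Finset ι, ∃ ε : ι → ℚ, (∀ j, ε j ^ 2 = 1) ∧
      ∀ y, (∀ j ∈ s, A y j = ε j * y j) → (∀ j ∉ s, y j = 0) → y = 0 by
    obtain ⟨ε, h1, h2⟩ := h Finset.univ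
    exact ⟨ε, h1, fun y hy => h2 y (fun j _ => hy j) (by simp)⟩
  intro s
  induction s using Finset.induction_on with
  | empty => exact ⟨1, by simp, fun y _ hy => funext fun j => hy j (by simp)⟩
  | insert a s ha ih =>
    obtain ⟨ε, h1, h2⟩ := ih
    by_contra hcon
    have hbad : ∀ c : ℚ, c ^ 2 = 1 → ∃ y : ι → ℚ, (∀ j ∈ s, A y j = ε j * y j) ∧
        A y a = c ∧ (∀ j ∉ insert a s, y j = 0) ∧ y a = 1 := by
      intro c hc
      by_contra hno
      refine hcon ⟨Function.update ε a c, fun j => ?_, fun y hy hy0 => ?_⟩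
      · rcases eq_or_ne j a with rfl | hj
        · simpa using hc
        · simpa [hj] using h1 j
      · have hys : ∀ j ∈ s, A y j = ε j * y j := fun j hj => by
          have hja : j ≠ a := fun e => ha (e ▸ hj)
          simpa [hja] using hy j (Finset.mem_insert_of_mem hj)
        by_cases hya : y a = 0
        · refine h2 y hys fun j hj => ?_
          rcases eq_or_ne j a with rfl | hja
          · exact hya
          · exact hy0 j (by simp [hja, hj])
        · refine absurd ⟨(y a)⁻¹ • y, fun j hj => ?_, ?_, fun j hj => ?_, ?_⟩ hno
          · simp only [map_smul, Pi.smul_apply, smul_eq_mul, hys j hj]; ring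
          · have := hy a (Finset.mem_insert_self a s)
            rw [Function.update_self] at this
            simp only [map_smul, Pi.smul_apply, smul_eq_mul, this]
            field_simp
          · simp [hy0 j hj]
          · simp [hya]
    obtain ⟨y, hy1, hy2, hy3, hy4⟩ := hbad 1 (by norm_num)
    obtain ⟨z, hz1, hz2, hz3, hz4⟩ := hbad (-1) (by norm_num)
    -- If both signs fail at `a`, the two normalised kernel vectors differ by a vector supported on
    -- `s`, hence coincide, although `A` gives them the values `1` and `-1` at `a`.
    have hyz : y - z = 0 := by
      refine h2 (y - z) (fun j hj => ?_) fun j hj => ?_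
      · simp only [map_sub, Pi.sub_apply, hy1 j hj, hz1 j hj]; ring
      · rcases eq_or_ne j a with rfl | hja
        · simp [hy4, hz4]
        · simp [hy3 j (by simp [hja, hj]), hz3 j (by simp [hja, hj])]
    rw [sub_eq_zero.1 hyz, hz2] at hy2
    norm_num at hy2

/-- Euler's four-square identity as a similarity of factor `n` of a sum of `4k` squares. -/
lemma exists_similarity (n k : ℕ) (hn : n ≠ 0) {κ : Type} [Fintype κ]
    (hκ : Fintype.card κ = 4 * k) :
    ∃ T : (κ → ℚ) ≃ₗ[ℚ] (κ → ℚ), ∀ x, ∑ i, (T x i) ^ 2 = n * ∑ i, (x i) ^ 2 := by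
  classical
  obtain ⟨a, b, c, d, habcd⟩ := Nat.sum_four_squares n
  have hq : (a : ℚ) ^ 2 + b ^ 2 + c ^ 2 + d ^ 2 = n := by exact_mod_cast habcd
  let e : κ ≃ Fin k × Fin 4 := Fintype.equivOfCardEq (by simp [hκ, mul_comm])
  let M : Matrix (Fin 4) (Fin 4) ℚ :=
    !![a, b, c, d; -b, a, -d, c; -c, d, a, -b; -d, -c, b, a]
  let T : (κ → ℚ) →ₗ[ℚ] (κ → ℚ) :=
    { toFun := fun x i => ∑ j, M (e i).2 j * x (e.symm ((e i).1, j))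
      map_add' := fun x y => by
        funext i; simp [mul_add, Finset.sum_add_distrib]
      map_smul' := fun r x => by
        funext i; simp [Finset.mul_sum, mul_left_comm] }
  have hT : ∀ x, ∑ i, (T x i) ^ 2 = n * ∑ i, (x i) ^ 2 := by
    intro x
    rw [← e.symm.sum_comp, ← e.symm.sum_comp, Fintype.sum_prod_type, Fintype.sum_prod_type,
      Finset.mul_sum]
    refine Finset.sum_congr rfl fun i _ => ?_
    simp only [T, LinearMap.coe_mk, AddHom.coe_mk, Equiv.apply_symm_apply, Fin.sum_univ_four, M]
    simp only [Matrix.of_apply, Matrix.cons_val]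
    rw [← hq]
    ring
  refine ⟨LinearEquiv.ofInjectiveEndo T ((injective_iff_map_eq_zero T).2 fun x hx => ?_), hT⟩
  have h0 := hT x
  simp only [hx, Pi.zero_apply, ne_eq, OfNat.ofNat_ne_zero, not_false_eq_true, zero_pow,
    Finset.sum_const_zero] at h0
  have h1 := (mul_eq_zero.1 h0.symm).resolve_left (by exact_mod_cast hn)
  funext i
  exact pow_eq_zero_iff (two_ne_zero) |>.1
    ((Finset.sum_eq_zero_iff_of_nonneg fun i _ => sq_nonneg (x i)).1 h1 i (Finset.mem_univ i))

/-- The algebraic core of the Bruck–Ryser theorem. -/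
lemma exists_eq_one_add_sq {ι : Type} [Fintype ι] {n k : ℕ} (hn : n ≠ 0)
    (hι : Fintype.card ι + 1 = 4 * k) (L : (ι → ℚ) →ₗ[ℚ] (ι → ℚ)) (w : (ι → ℚ) →ₗ[ℚ] ℚ)
    (hL : ∀ x, ∑ j, (L x j) ^ 2 = n * ∑ i, (x i) ^ 2 + (w x) ^ 2) :
    ∃ z t : ℚ, n * z ^ 2 = 1 + t ^ 2 := by
  classical
  -- One extra variable `none` makes the number of squares divisible by 4; with `Y = T x` the
  -- identity becomes `∑ L_j² + n x_none² = ∑ Y_i² + w²`.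
  obtain ⟨T, hT⟩ := exists_similarity n k hn (κ := Option ι) (by simp [hι])
  let res : (Option ι → ℚ) →ₗ[ℚ] (ι → ℚ) := LinearMap.funLeft ℚ ℚ some
  let ext : (ι → ℚ) →ₗ[ℚ] (Option ι → ℚ) :=
    { toFun := fun y i => i.elim 0 y
      map_add' := fun y z => by funext i; cases i <;> simp
      map_smul' := fun r z => by funext i; cases i <;> simp }
  let F : (Option ι → ℚ) →ₗ[ℚ] (ι → ℚ) := L ∘ₗ res ∘ₗ T.symm.toLinearMap
  obtain ⟨ε, hε, hinj⟩ := exists_signs_injective (F ∘ₗ ext)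
  let G : (ι → ℚ) →ₗ[ℚ] (ι → ℚ) := F ∘ₗ ext - LinearMap.pi fun j => ε j • LinearMap.proj j
  have hG : Function.Injective G := (injective_iff_map_eq_zero G).2 fun y hy =>
    hinj y fun j => by
      have := congrFun hy j
      simpa [G, sub_eq_zero] using this
  let u : Option ι → ℚ := fun i => i.elim 1 fun _ => 0
  -- This solves `L_j = ± Y_j` for all `j` at once with `Y_none = 1`; all squares except `n x_none²
  -- = 1 + w²` then cancel.
  obtain ⟨y, hy⟩ := LinearMap.injective_iff_surjective.1 hG (-F u)
  let Y := ext y + u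
  have hF : ∀ j, F Y j = ε j * y j := by
    intro j
    have := congrFun hy j
    simp only [G, LinearMap.sub_apply, LinearMap.comp_apply, Pi.sub_apply, LinearMap.pi_apply,
      LinearMap.smul_apply, LinearMap.proj_apply, smul_eq_mul, Pi.neg_apply] at this
    simp only [Y, map_add, Pi.add_apply]
    linarith
  have h1 := hT (T.symm Y)
  have h2 := hL (res (T.symm Y))
  rw [T.apply_symm_apply, Fintype.sum_option, Fintype.sum_option] at h1
  have h3 : ∀ j, L (res (T.symm Y)) j = ε j * y j := hF
  have h4 : ∀ j, res (T.symm Y) j = T.symm Y (some j) := fun j => rfl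
  have h5 : Y none = 1 := by simp [Y, ext, u]
  have h6 : ∀ j, Y (some j) = y j := by simp [Y, ext, u]
  simp only [h3, h4, mul_pow, hε, one_mul] at h2
  simp only [h5, h6] at h1
  refine ⟨T.symm Y none, w (res (T.symm Y)), ?_⟩
  linear_combination h2 - h1

/-- After clearing denominators, a sum of two squares would contain the prime `3 ≡ 3 (mod 4)` to an
odd power. -/
lemma not_exists_eq_one_add_sq (k : ℕ) :
    ¬ ∃ z t : ℚ, ((2 * 3 ^ (2 * k + 1) : ℕ) : ℚ) * z ^ 2 = 1 + t ^ 2 := by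
  rintro ⟨z, t, h⟩
  set n := 2 * 3 ^ (2 * k + 1)
  have hz : z ≠ 0 := by
    rintro rfl
    nlinarith [sq_nonneg t]
  have hzn : z.num.natAbs ≠ 0 := by simpa using hz
  have hnat : n * (z.num.natAbs * t.den) ^ 2 =
      (z.den * t.den) ^ 2 + (t.num.natAbs * z.den) ^ 2 := by
    have hzd : (z.den : ℚ) ≠ 0 := by exact_mod_cast z.den_nz
    have htd : (t.den : ℚ) ≠ 0 := by exact_mod_cast t.den_nz
    rw [← Rat.num_div_den z, ← Rat.num_div_den t] at h
    field_simp at h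
    have h' : (n : ℤ) * (z.num * t.den) ^ 2 = (z.den * t.den) ^ 2 + (t.num * z.den) ^ 2 := by
      have : (n : ℚ) * (z.num * t.den) ^ 2 = (z.den * t.den) ^ 2 + (t.num * z.den) ^ 2 := by
        linear_combination h
      exact_mod_cast this
    zify
    rw [mul_pow, mul_pow (|t.num|), sq_abs, sq_abs, ← mul_pow, ← mul_pow]
    exact h'
  have hn0 : n ≠ 0 := by positivity
  have hm0 : (z.num.natAbs * t.den) ^ 2 ≠ 0 := pow_ne_zero _ (mul_ne_zero hzn t.den_nz)
  have hval : padicValNat 3 (n * (z.num.natAbs * t.den) ^ 2) =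
      2 * k + 1 + 2 * padicValNat 3 (z.num.natAbs * t.den) := by
    have : Fact (Nat.Prime 3) := ⟨Nat.prime_three⟩
    rw [padicValNat.mul hn0 hm0, padicValNat.pow,
      padicValNat.mul two_ne_zero (by positivity), padicValNat.prime_pow,
      padicValNat.eq_zero_of_not_dvd (by norm_num : ¬ 3 ∣ 2), zero_add]
  have heven := Nat.eq_sq_add_sq_iff.1 ⟨_, _, hnat⟩ 3 (Nat.mem_primeFactors.2
    ⟨Nat.prime_three, (Dvd.intro_left (2 * 3 ^ (2 * k)) (by ring)).mul_right _,
      mul_ne_zero hn0 hm0⟩) (by norm_num)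
  rw [hval] at heven
  rw [Nat.even_iff] at heven
  omega

/-! ### Affine planes from direction maps -/

namespace IsDirectionMap

variable {U P : Type} {dir : U → U → Option P}

lemma exists_dir_eq (H : IsDirectionMap dir) (x : U) (p : P) : ∃ z, dir x z = some p := by
  obtain ⟨z, hz, -⟩ := H.exists_of_cycle x x (some p) (some p) (by
    rw [(H.eq_none_iff x x).2 rfl]; rfl)
  exact ⟨z, hz⟩

/-- View the line through `o` of direction `p` from a point `y` off it: its points other than `o`
appear once each in every direction except `p` and the direction `r` of `o`. -/
lemma ncard_dir_eq [Finite P] [Nontrivial P] (H : IsDirectionMap dir) (o : U) (p : P) :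
    {x | dir o x = some p}.Finite ∧ {x | dir o x = some p}.ncard + 2 = Nat.card P := by
  obtain ⟨r, hr⟩ := exists_ne p
  obtain ⟨y, hy⟩ := H.exists_dir_eq o r
  have hinj : Set.InjOn (dir y) {x | dir o x = some p} := by
    intro x hx x' hx' hxx'
    have h1 := H.cycle x o x'
    have h2 := H.cycle x y x'
    rw [H.symm x o, show dir o x = some p from hx, show dir o x' = some p from hx'] at h1
    have h3 := H.cycle y o x
    rw [H.symm y o, hy, show dir o x = some p from hx] at h3
    rw [H.symm x y, hxx'] at h2
    rw [hxx'] at h3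
    rw [← H.eq_none_iff]
    rcases hd : dir x x' with _ | d
    · rfl
    rcases he : dir y x' with _ | e <;> rw [hd] at h1 h2 <;> rw [he] at h2 h3 <;>
      simp only [LyndonCycle] at h1 h2 h3 <;> grind
  have himg : dir y '' {x | dir o x = some p} = ({none, some p, some r} : Set (Option P))ᶜ := by
    ext d
    constructor
    · rintro ⟨x, hx, rfl⟩
      have h3 := H.cycle y o x
      rw [H.symm y o, hy, show dir o x = some p from hx] at h3
      rcases hd : dir y x with _ | d <;> rw [hd] at h3 <;> simp only [LyndonCycle] at h3 <;>
        simp <;> grind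
    · intro hd
      rcases d with _ | d
      · simp at hd
      simp only [Set.mem_compl_iff, Set.mem_insert_iff, Set.mem_singleton_iff, Option.some.injEq,
        reduceCtorEq, false_or, not_or] at hd
      obtain ⟨x, hx1, hx2⟩ := H.exists_of_cycle o y (some p) (some d) (by
        rw [hy]; exact Or.inr ⟨Ne.symm hd.1, hd.2, hr.symm⟩)
      exact ⟨x, hx1, by rw [H.symm, hx2]⟩
  have hcard := Set.ncard_compl ({none, some p, some r} : Set (Option P))
  have h3 : ({none, some p, some r} : Set (Option P)).ncard = 3 :=
    Set.ncard_eq_three.2 ⟨none, some p, some r, by simp, by simp, by simpa using hr.symm, rfl⟩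
  rw [← himg, hinj.ncard_image, h3, Finite.card_option] at hcard
  have h2 : 2 ≤ Nat.card P := Finite.one_lt_card
  exact ⟨Set.Finite.of_finite_image (Set.toFinite _) hinj, by omega⟩

lemma finite [Finite P] [Nontrivial P] (H : IsDirectionMap dir) : Finite U := by
  rcases isEmpty_or_nonempty U with _ | ⟨⟨o⟩⟩
  · infer_instance
  have hcover : (Set.univ : Set U) = {o} ∪ ⋃ p, {x | dir o x = some p} := by
    ext x
    simp only [Set.mem_univ, Set.mem_union, Set.mem_singleton_iff, Set.mem_iUnion,
      Set.mem_ofPred_eq, true_iff]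
    rcases hd : dir o x with _ | p
    · exact Or.inl ((H.eq_none_iff o x).1 hd).symm
    · exact Or.inr ⟨p, rfl⟩
  rw [← Set.finite_univ_iff, hcover]
  exact (Set.finite_singleton o).union (Set.finite_iUnion fun p => (H.ncard_dir_eq o p).1)

/-- The parallel class of direction `p`: two points are related if they lie on a common line of
direction `p`. -/
def parallel (H : IsDirectionMap dir) (p : P) : Setoid U where
  r x y := dir x y = none ∨ dir x y = some p
  iseqv := by
    refine ⟨fun x => Or.inl ((H.eq_none_iff x x).2 rfl), fun {x y} h => by rwa [H.symm y x], ?_⟩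
    intro x y z h1 h2
    have h := H.cycle x y z
    rcases h1 with h1 | h1 <;> rcases h2 with h2 | h2 <;> rw [h1, h2] at h
    · exact Or.inl h.symm
    · exact Or.inr h.symm
    · exact Or.inr h
    · rcases hd : dir x z with _ | d
      · exact Or.inl rfl
      · rw [hd] at h
        rcases h with ⟨-, rfl⟩ | ⟨h, -⟩
        · exact Or.inr rfl
        · exact absurd rfl h

lemma mk_eq_mk_iff (H : IsDirectionMap dir) (p : P) (x y : U) :
    Quotient.mk (H.parallel p) x = Quotient.mk (H.parallel p) y ↔
      dir x y = none ∨ dir x y = some p := Quotient.eq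

open Classical in
lemma card_fiber [Fintype U] [Finite P] [Nontrivial P] (H : IsDirectionMap dir) (o : U) (p : P) :
    (Finset.univ.filter fun x => dir o x = some p).card + 2 = Nat.card P := by
  rw [← (H.ncard_dir_eq o p).2, Set.ncard_eq_toFinset_card']
  simp

open Classical in
lemma card_points [Fintype U] [Nonempty U] [Fintype P] (H : IsDirectionMap dir) {q : ℕ}
    (hq : 1 ≤ q) (hP : Fintype.card P = q + 1) : Fintype.card U = q ^ 2 := by
  have : Nontrivial P := Fintype.one_lt_card_iff_nontrivial.1 (by omega)
  obtain ⟨o⟩ := ‹Nonempty U›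
  have h := Finset.card_eq_sum_card_fiberwise (s := (Finset.univ : Finset U))
    (t := (Finset.univ : Finset (Option P))) (f := dir o) (fun _ _ => Finset.mem_univ _)
  have hnone : (Finset.univ.filter fun x => dir o x = none).card = 1 := by
    rw [Finset.card_eq_one]
    exact ⟨o, by ext x; simp [H.eq_none_iff, eq_comm]⟩
  have hsome : ∀ p, (Finset.univ.filter fun x => dir o x = some p).card = q - 1 := fun p => by
    have := H.card_fiber o p
    rw [Nat.card_eq_fintype_card, hP] at this
    omega
  rw [Finset.card_univ, Fintype.sum_option, hnone] at h
  simp only [hsome, Finset.sum_const, Finset.card_univ, hP, smul_eq_mul] at h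
  -- The count is `1 + (q + 1)(q - 1)`: the point `o` itself and `q - 1` further points in each
  -- direction.
  rw [h]
  obtain ⟨k, rfl⟩ := Nat.exists_eq_add_of_le hq
  simp only [Nat.add_sub_cancel_left]
  ring

open Classical in
lemma card_lines [Fintype U] [Nonempty U] [Fintype P] (H : IsDirectionMap dir) {q : ℕ}
    (hq : 1 ≤ q) (hP : Fintype.card P = q + 1) (p : P) :
    Fintype.card (Quotient (H.parallel p)) = q := by
  have : Nontrivial P := Fintype.one_lt_card_iff_nontrivial.1 (by omega)
  have h := Finset.card_eq_sum_card_fiberwise (s := (Finset.univ : Finset U))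
    (t := (Finset.univ : Finset (Quotient (H.parallel p)))) (f := Quotient.mk _)
    (fun _ _ => Finset.mem_univ _)
  have hfib : ∀ c : Quotient (H.parallel p),
      (Finset.univ.filter fun x => Quotient.mk (H.parallel p) x = c).card = q := by
    intro c
    induction c using Quotient.inductionOn with | _ o
    have h1 := H.card_fiber o p
    rw [Nat.card_eq_fintype_card, hP] at h1
    have h2 : (Finset.univ.filter fun x => Quotient.mk (H.parallel p) x = Quotient.mk _ o) =
        insert o (Finset.univ.filter fun x => dir o x = some p) := by
      ext x
      simp only [Finset.mem_filter, Finset.mem_univ, true_and, Finset.mem_insert]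
      rw [H.mk_eq_mk_iff, H.symm x o, H.eq_none_iff, eq_comm (a := o)]
    rw [h2, Finset.card_insert_of_notMem (by simp [(H.eq_none_iff o o).2 rfl])]
    omega
  simp only [hfib, Finset.sum_const, Finset.card_univ, smul_eq_mul, H.card_points hq hP] at h
  exact Nat.eq_of_mul_eq_mul_right hq (by rw [← h, sq])

open Classical in
-- Expand the squares: a point lies on `q + 1` lines, and two distinct points lie together on
-- exactly one.
lemma sum_sq_lines [Fintype U] [Nonempty U] [Fintype P] (H : IsDirectionMap dir) {q : ℕ}
    (hP : Fintype.card P = q + 1) (x : U → ℚ) :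
    ∑ p, ∑ c : Quotient (H.parallel p), (∑ u with Quotient.mk _ u = c, x u) ^ 2 =
      q * ∑ u, x u ^ 2 + (∑ u, x u) ^ 2 := by
  have h1 : ∀ p, ∑ c : Quotient (H.parallel p), (∑ u with Quotient.mk _ u = c, x u) ^ 2 =
      ∑ u, ∑ v, x u * if dir u v = none ∨ dir u v = some p then x v else 0 := by
    intro p
    rw [← Finset.sum_fiberwise Finset.univ (Quotient.mk (H.parallel p))]
    refine Finset.sum_congr rfl fun c _ => ?_
    rw [sq, Finset.sum_mul]
    refine Finset.sum_congr rfl fun u hu => ?_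
    rw [Finset.sum_filter, Finset.mul_sum]
    refine Finset.sum_congr rfl fun v _ => ?_
    refine congrArg (x u * ·) (if_congr ?_ rfl rfl)
    rw [← (Finset.mem_filter.1 hu).2, eq_comm, H.mk_eq_mk_iff]
  have h2 : ∀ u v, ∑ p, (x u * if dir u v = none ∨ dir u v = some p then x v else 0) =
      x u * x v + if u = v then q * (x u * x v) else 0 := by
    intro u v
    rw [← H.eq_none_iff u v]
    rcases hd : dir u v with _ | d
    · simp [hP]; ring
    · simp
  simp only [h1]
  rw [Finset.sum_comm]
  simp only [Finset.sum_comm (s := (Finset.univ : Finset P)), h2, Finset.sum_add_distrib,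
    Finset.sum_ite_eq, Finset.mem_univ, if_true]
  rw [sq (∑ u, x u), Finset.sum_mul_sum, Finset.mul_sum, add_comm]
  simp only [sq]

/-- The Bruck–Ryser theorem for the projective closure of the affine plane of a direction map. -/
theorem exists_eq_one_add_sq [Nonempty U] [Fintype P] (H : IsDirectionMap dir) {q : ℕ}
    (hq : q % 4 = 2) (hP : Fintype.card P = q + 1) : ∃ z t : ℚ, q * z ^ 2 = 1 + t ^ 2 := by
  classical
  have : Nontrivial P := Fintype.one_lt_card_iff_nontrivial.1 (by omega)
  have := H.finite
  have := Fintype.ofFinite U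
  have hq1 : 1 ≤ q := by omega
  have hlines : Fintype.card ((Σ p, Quotient (H.parallel p)) ⊕ Unit) = q ^ 2 + q + 1 := by
    simp only [Fintype.card_sum, Fintype.card_sigma, H.card_lines hq1 hP, Finset.sum_const,
      Finset.card_univ, hP, smul_eq_mul, Fintype.card_unit]
    ring
  have hpoints : Fintype.card (U ⊕ P) = q ^ 2 + q + 1 := by
    rw [Fintype.card_sum, H.card_points hq1 hP, hP, add_assoc]
  -- Each affine line gains its direction as a point, and `Unit` is the line at infinity. Any
  -- bijection of points with lines will do: it only indexes the linear forms by the variables.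
  let σ : (U ⊕ P) ≃ (Σ p, Quotient (H.parallel p)) ⊕ Unit :=
    Fintype.equivOfCardEq (hpoints.trans hlines.symm)
  let form : (Σ p, Quotient (H.parallel p)) ⊕ Unit → (U ⊕ P → ℚ) →ₗ[ℚ] ℚ := Sum.elim
    (fun l => (∑ u with Quotient.mk _ u = l.2, LinearMap.proj (Sum.inl u)) +
      LinearMap.proj (Sum.inr l.1))
    (fun _ => ∑ p, LinearMap.proj (Sum.inr p))
  obtain ⟨k, hk⟩ : ∃ k, q = 4 * k + 2 := ⟨q / 4, by omega⟩
  -- For `q = 4k + 2` one has `q² + q + 2 = 4 (4k² + 5k + 2)`; this is where `q ≡ 2 (mod 4)` enters.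
  refine _root_.exists_eq_one_add_sq (ι := U ⊕ P) (k := 4 * k ^ 2 + 5 * k + 2) (by omega) ?_
    (LinearMap.pi fun j => form (σ j)) (∑ i, LinearMap.proj i) fun x => ?_
  · rw [hpoints, hk]; ring
  · simp only [LinearMap.pi_apply]
    rw [σ.sum_comp fun l => form l x ^ 2, Fintype.sum_sum_type, Fintype.sum_sigma]
    have h1 : ∀ p, ∑ c : Quotient (H.parallel p), form (Sum.inl ⟨p, c⟩) x ^ 2 =
        ∑ c : Quotient (H.parallel p), (∑ u with Quotient.mk _ u = c, x (Sum.inl u)) ^ 2 +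
          2 * (∑ u, x (Sum.inl u)) * x (Sum.inr p) + q * x (Sum.inr p) ^ 2 := by
      intro p
      rw [← Finset.sum_fiberwise Finset.univ (Quotient.mk (H.parallel p)), Finset.mul_sum,
        Finset.sum_mul, ← Finset.sum_add_distrib]
      have hc : (q : ℚ) * x (Sum.inr p) ^ 2 =
          ∑ _c : Quotient (H.parallel p), x (Sum.inr p) ^ 2 := by
        rw [Finset.sum_const, Finset.card_univ, H.card_lines hq1 hP, nsmul_eq_mul]
      rw [hc, ← Finset.sum_add_distrib]
      refine Finset.sum_congr rfl fun c _ => ?_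
      simp only [form, Sum.elim_inl, LinearMap.add_apply, LinearMap.sum_apply,
        LinearMap.proj_apply]
      ring
    simp only [h1, Finset.sum_add_distrib, H.sum_sq_lines hP fun u => x (Sum.inl u),
      ← Finset.mul_sum]
    simp only [form, Sum.elim_inr, LinearMap.add_apply, LinearMap.sum_apply, LinearMap.proj_apply,
      Fintype.sum_sum_type, Finset.univ_unique, Finset.sum_singleton]
    ring

end IsDirectionMap

/-! ### Nonrepresentable Lyndon algebras -/

/-- A representation of a finite Lyndon algebra yields a direction map. -/
lemma exists_isDirectionMap_of_RRA {P : Type} [Finite P] (h : RRA (Set (Option P))) :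
    ∃ (U : Type) (dir : U → U → Option P), Nonempty U ∧ IsDirectionMap dir := by
  classical
  obtain ⟨U, E, h, H⟩ := h
  have hE := H.equivalence
  -- Finiteness of `P` makes the representation complete: every pair of `E` lies in the image of an
  -- atom.
  have hsum : ∀ X : Set (Option P), ∀ p ∈ h X, ∃ a ∈ X, p ∈ h {a} := by
    intro X
    induction X, Set.toFinite X using Set.Finite.induction_on with
    | empty => intro p hp; rw [show h ∅ = ∅ from H.map_zero] at hp; exact hp.elim
    | @insert a X _ _ ih =>
      intro p hp
      rw [Set.insert_eq, show h ({a} ∪ X) = h {a} ∪ h X from H.map_add _ _] at hp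
      rcases hp with hp | hp
      · exact ⟨a, Set.mem_insert _ _, hp⟩
      · obtain ⟨b, hb, hp⟩ := ih p hp
        exact ⟨b, Set.mem_insert_of_mem _ hb, hp⟩
  have hmono : ∀ X Y : Set (Option P), X ⊆ Y → h X ⊆ h Y := by
    intro X Y hXY
    rw [← Set.union_eq_right.2 hXY, show h (X ∪ Y) = h X ∪ h Y from H.map_add _ _]
    exact Set.subset_union_left
  have hdisj : ∀ a b p, p ∈ h {a} → p ∈ h {b} → a = b := by
    intro a b p ha hb
    by_contra hab
    have h0 : p ∈ h (({a} : Set (Option P)) ∩ {b}) := by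
      rw [show h ({a} ∩ {b}) = h {a} ∩ h {b} from H.map_mul _ _]; exact ⟨ha, hb⟩
    rw [Set.singleton_inter_eq_empty.2 (by simpa using hab),
      show h ∅ = ∅ from H.map_zero] at h0
    exact h0
  obtain ⟨⟨o, o'⟩, ho⟩ : E.Nonempty := by
    rw [Set.nonempty_iff_ne_empty, ← show h Set.univ = E from H.map_one,
      ← show h ∅ = ∅ from H.map_zero]
    exact fun e => Set.empty_ne_univ (H.injective e).symm
  -- A direction map labels all pairs, so the base is cut down to one equivalence class.
  let C := {x // (o, x) ∈ E}
  have hC : ∀ x y : C, ∃ a, (x.1, y.1) ∈ h {a} := fun x y => by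
    have hxy : (x.1, y.1) ∈ h Set.univ := by
      rw [show h Set.univ = E from H.map_one]
      exact hE.trans (hE.symm x.2) y.2
    obtain ⟨a, -, ha⟩ := hsum _ _ hxy
    exact ⟨a, ha⟩
  choose dir hdir using hC
  have hdir_eq : ∀ x y a, (x.1, y.1) ∈ h {a} → dir x y = a :=
    fun x y a ha => hdisj _ _ _ (hdir x y) ha
  have hcomp : ∀ a b : Option P, h {c | LyndonCycle a b c} =
      {p | ∃ y, (p.1, y) ∈ h {a} ∧ (y, p.2) ∈ h {b}} := by
    intro a b
    rw [← H.map_comp]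
    congr 1
    ext c
    simp [RelAlg.comp]
  refine ⟨C, dir, ⟨⟨o, hE.refl o⟩⟩, fun x y => ?_, fun x y => ?_, fun x z y => ?_,
    fun x y a b hab => ?_⟩
  · have hid : h {none} = {p | p.1 = p.2} := H.map_ident
    constructor
    · intro hxy
      have := hdir x y
      rw [hxy, hid] at this
      exact Subtype.ext this
    · rintro rfl
      exact hdir_eq _ _ _ (by rw [hid]; rfl)
  · refine hdir_eq _ _ _ ?_
    have hconv : h {dir y x} = {p | (p.2, p.1) ∈ h {dir y x}} := H.map_conv _
    rw [hconv]
    exact hdir y x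
  · have hxy : (x.1, y.1) ∈ h {c | LyndonCycle (dir x z) (dir z y) c} := by
      rw [hcomp]
      exact ⟨z, hdir x z, hdir z y⟩
    obtain ⟨c, hc, hxy⟩ := hsum _ _ hxy
    rw [hdir_eq _ _ _ hxy]
    exact hc
  · have hxy : (x.1, y.1) ∈ h {c | LyndonCycle a b c} :=
      hmono _ _ (Set.singleton_subset_iff.2 hab) (hdir x y)
    rw [hcomp] at hxy
    obtain ⟨z, h1, h2⟩ := hxy
    exact ⟨⟨z, hE.trans x.2 (H.subset _ h1)⟩, hdir_eq _ _ _ h1, hdir_eq _ _ _ h2⟩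

lemma two_mul_three_pow_mod_four (n : ℕ) : 2 * 3 ^ (2 * n + 1) % 4 = 2 := by
  induction n with
  | zero => rfl
  | succ n ih =>
    rw [show 2 * (n + 1) + 1 = 2 * n + 1 + 2 by ring, pow_add]
    omega

/-- The Lyndon algebra of a line of order `2 · 3 ^ (2n+1)` is not representable. -/
theorem not_lyndon_RRA (n : ℕ) : ¬ RRA (Set (Option (Fin (2 * 3 ^ (2 * n + 1) + 1)))) := by
  intro h
  obtain ⟨U, dir, _, H⟩ := exists_isDirectionMap_of_RRA h
  exact not_exists_eq_one_add_sq n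
    (H.exists_eq_one_add_sq (two_mul_three_pow_mod_four n) (Fintype.card_fin _))

/-! ### Existence of `β*`: counting elements by atoms -/

/-- Huntington's axioms for a Boolean algebra with operations `f`, `g`, complement `c` and
constants `z`, `o`, in a form that is symmetric under duality. -/
structure IsHuntington {A : Type} (f g : A → A → A) (c : A → A) (z o : A) : Prop where
  comm : ∀ x y, f x y = f y x
  comm' : ∀ x y, g x y = g y x
  distrib : ∀ x y w, f x (g y w) = g (f x y) (f x w)
  distrib' : ∀ x y w, g x (f y w) = f (g x y) (g x w)
  neutral : ∀ x, f x z = x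
  neutral' : ∀ x, g x o = x
  compl : ∀ x, f x (c x) = o
  compl' : ∀ x, g x (c x) = z

namespace IsHuntington

variable {A : Type} {f g : A → A → A} {c : A → A} {z o : A}

lemma dual (H : IsHuntington f g c z o) : IsHuntington g f c o z :=
  ⟨H.comm', H.comm, H.distrib', H.distrib, H.neutral', H.neutral, H.compl', H.compl⟩

lemma top (H : IsHuntington f g c z o) (x : A) : f x o = o := by
  have h := H.distrib x (c x) o
  rw [H.neutral', H.compl, H.comm', H.neutral'] at h
  exact h.symm

lemma absorb (H : IsHuntington f g c z o) (x y : A) : f x (g x y) = x := by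
  have h := H.distrib' x o y
  rw [H.neutral', H.comm o, H.top, H.neutral'] at h
  exact h.symm

/-- An element is recovered from its parts under `x` and under the complement of `x`; comparing
these parts yields associativity. -/
lemma eq_of_eq (H : IsHuntington f g c z o) (x : A) {a b : A} (h1 : g x a = g x b)
    (h2 : g (c x) a = g (c x) b) : a = b := by
  rw [← H.neutral' a, ← H.neutral' b, ← H.compl x, H.distrib', H.distrib', H.comm' a x,
    H.comm' a (c x), h1, h2, H.comm' x b, H.comm' (c x) b]

lemma assoc (H : IsHuntington f g c z o) (x y w : A) : f (f x y) w = f x (f y w) := by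
  apply H.eq_of_eq x
  · rw [H.dual.absorb, H.distrib', H.dual.absorb, H.absorb]
  · rw [H.distrib', H.distrib' _ x y, H.distrib' _ x (f y w), H.comm' (c x) x, H.compl',
      H.comm z, H.comm z, H.neutral, H.neutral, H.distrib']

/-- The Boolean algebra given by Huntington's axioms. -/
@[reducible] def toBooleanAlgebra (H : IsHuntington f g c z o) : BooleanAlgebra A :=
  letI : Max A := ⟨f⟩
  letI : Min A := ⟨g⟩
  letI := Lattice.mk' (α := A) H.comm H.assoc H.comm' H.dual.assoc H.absorb H.dual.absorb
  letI := DistribLattice.ofInfSupLe (α := A) fun x y w => le_of_eq (H.distrib' x y w)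
  { compl := c
    top := o
    bot := z
    le_top := fun x => sup_eq_right.1 (H.top x)
    bot_le := fun x => sup_eq_right.1 ((H.comm z x).trans (H.neutral x))
    inf_compl_le_bot := fun x => le_of_eq (H.compl' x)
    top_le_sup_compl := fun x => le_of_eq (H.compl x).symm }

end IsHuntington

lemma IsRelationAlgebra.isHuntington {A : Type} [RelAlg A] (H : IsRelationAlgebra A) :
    IsHuntington (A := A) RelAlg.add RelAlg.mul RelAlg.compl RelAlg.zero RelAlg.one :=
  ⟨H.add_comm, H.mul_comm, H.add_mul_distrib, H.mul_add_distrib, H.add_zero, H.mul_one,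
    H.add_compl, H.mul_compl⟩

lemma card_le_of_isRelationAlgebra {A : Type} [RelAlg A] [Finite A] (H : IsRelationAlgebra A) :
    Nat.card A ≤ 2 ^ (relAtoms A).ncard := by
  let B := H.isHuntington.toBooleanAlgebra
  have hle : ∀ x a : A, B.le x a ↔ RelAlg.mul x a = x := fun x a => inf_eq_left.symm
  have hatom : ∀ x : A, IsAtom x → x ∈ relAtoms A := fun x hx =>
    ⟨hx.1, fun y hy => hx.le_iff.1 ((hle y x).2 hy)⟩
  let φ : A → Set (relAtoms A) := fun a => {x | RelAlg.mul x.1 a = x.1}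
  have hφ : Function.Injective φ := by
    intro a b hab
    refine BooleanAlgebra.eq_iff_atom_le_iff.2 fun x hx => ?_
    exact (hle x a).trans ((Set.ext_iff.1 hab ⟨x, hatom x hx⟩).trans (hle x b).symm)
  have := Fintype.ofFinite (relAtoms A)
  refine (Nat.card_le_card_of_injective φ hφ).trans (le_of_eq ?_)
  rw [Nat.card_eq_fintype_card, Fintype.card_set, ← Nat.card_eq_fintype_card,
    Nat.card_coe_set_eq]

lemma isLeast_atomEqComplexity (M : ℕ) :
    IsLeast (atomComplexityBounds RRA M) (atomEqComplexity RRA M) := by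
  refine ⟨Nat.sInf_mem ⟨sufficientLength (2 ^ M), fun A _ _ hRA hM => ?_⟩,
    fun _ hN => Nat.sInf_le hN⟩
  exact sufficientLength_mem_complexityBounds (2 ^ M) A ‹_› ((card_le_of_isRelationAlgebra hRA).trans
    (Nat.pow_le_pow_right (by norm_num) hM))

/-! ### Numerical bounds -/

/-- If `N + 2 ≤ 2 log₂ 3 · (2n + 1)`, then `2 ^ ((N + 2) / 2) ≤ 3 ^ (2n + 1)`, fewer than the points
of the line. -/
lemma lt_of_not_satisfiesUpTo_lyndon (n N : ℕ)
    (h : ¬ SatisfiesUpTo RRA N (Set (Option (Fin (2 * 3 ^ (2 * n + 1) + 1))))) :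
    2 * Real.logb 2 3 * (2 * (n : ℝ) + 1) - 2 < N := by
  by_contra! hle
  refine h (lyndon_satisfiesUpTo ?_)
  rw [Nat.card_eq_fintype_card, Fintype.card_fin]
  suffices hs : 2 ^ ((N + 2) / 2) ≤ 3 ^ (2 * n + 1) by omega
  have h1 : (((N + 2) / 2 : ℕ) : ℝ) ≤ Real.logb 2 3 * ((2 * n + 1 : ℕ) : ℝ) := by
    refine Nat.cast_div_le.trans ?_
    push_cast
    linarith
  have h2 : (2 : ℝ) ^ ((N + 2) / 2) ≤ 3 ^ (2 * n + 1) := by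
    rw [← Real.rpow_natCast, ← Real.rpow_natCast]
    refine (Real.rpow_le_rpow_of_exponent_le (by norm_num) h1).trans ?_
    rw [Real.rpow_mul (by norm_num), Real.rpow_logb (by norm_num) (by norm_num) (by norm_num)]
  exact_mod_cast h2

lemma lt_of_mem_complexityBounds {m n N : ℕ} (hm : 2 ^ (2 * 3 ^ (2 * n + 1) + 2) ≤ m)
    (hN : N ∈ complexityBounds RRA m) : 2 * Real.logb 2 3 * (2 * (n : ℝ) + 1) - 2 < N := by
  refine lt_of_not_satisfiesUpTo_lyndon n N fun h => not_lyndon_RRA n ((hN _ inferInstance ?_).2 h)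
  rw [Nat.card_eq_fintype_card, Fintype.card_set, Fintype.card_option, Fintype.card_fin]
  exact hm

lemma lt_of_mem_atomComplexityBounds {M n N : ℕ} (hM : 2 * 3 ^ (2 * n + 1) + 2 ≤ M)
    (hN : N ∈ atomComplexityBounds RRA M) : 2 * Real.logb 2 3 * (2 * (n : ℝ) + 1) - 2 < N := by
  refine lt_of_not_satisfiesUpTo_lyndon n N fun h => not_lyndon_RRA n
    ((hN _ inferInstance (lyndon_isRelationAlgebra fun a b c d => ?_) ?_).2 h)
  · have h5 : ({a, b, c, d} : Finset (Fin (2 * 3 ^ (2 * n + 1) + 1))).card <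
        (Finset.univ : Finset (Fin (2 * 3 ^ (2 * n + 1) + 1))).card := by
      refine Finset.card_le_four.trans_lt ?_
      have : 3 ^ 1 ≤ 3 ^ (2 * n + 1) := Nat.pow_le_pow_right (by norm_num) (by omega)
      rw [Finset.card_univ, Fintype.card_fin]
      omega
    obtain ⟨e, -, he⟩ := Finset.exists_mem_notMem_of_card_lt_card h5
    simp only [Finset.mem_insert, Finset.mem_singleton, not_or] at he
    exact ⟨e, he⟩
  · refine (lyndon_relAtoms_ncard_le _).trans ?_
    rw [Nat.card_eq_fintype_card, Fintype.card_fin]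
    exact hM

/-- The largest odd power of `3` below `x` has an exponent exceeding `log₃ x - 2`. -/
lemma exists_odd_pow_le {x : ℝ} (hx : 3 ≤ x) :
    ∃ n : ℕ, (3 : ℝ) ^ (2 * n + 1) ≤ x ∧ Real.logb 3 x - 2 < 2 * n + 1 := by
  have h1 : 1 ≤ Real.logb 3 x := by
    rw [Real.le_logb_iff_rpow_le (by norm_num) (by linarith), Real.rpow_one]; exact hx
  refine ⟨⌊(Real.logb 3 x - 1) / 2⌋₊, ?_, ?_⟩
  · have h2 := Nat.floor_le (a := (Real.logb 3 x - 1) / 2) (by linarith)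
    rw [← Real.rpow_natCast, ← Real.le_logb_iff_rpow_le (by norm_num) (by linarith)]
    push_cast
    linarith
  · have h2 := Nat.lt_floor_add_one ((Real.logb 3 x - 1) / 2)
    linarith

lemma logb_two_three_pos : 0 < Real.logb 2 3 := Real.logb_pos (by norm_num) (by norm_num)

theorem lt_eqComplexity (m : ℕ) (hm : 2 ^ 8 ≤ m) : (eqComplexity RRA m : ℝ) >
    2 * Real.logb 2 3 * (Real.logb 3 (1 / 2 * Real.logb 2 (m : ℝ) - 1) - 2) - 2 := by
  have hm' : ((2 ^ 8 : ℕ) : ℝ) ≤ m := by exact_mod_cast hm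
  have hm0 : (0 : ℝ) < m := lt_of_lt_of_le (by norm_num) hm'
  have h8 : 8 ≤ Real.logb 2 m := by
    rw [Real.le_logb_iff_rpow_le (by norm_num) hm0]
    exact_mod_cast hm
  obtain ⟨n, h1, h2⟩ := exists_odd_pow_le (x := 1 / 2 * Real.logb 2 m - 1) (by linarith)
  have h3 : 2 ^ (2 * 3 ^ (2 * n + 1) + 2) ≤ m := by
    have h4 : (((2 * 3 ^ (2 * n + 1) + 2 : ℕ)) : ℝ) ≤ Real.logb 2 m := by
      push_cast; linarith
    rw [Real.le_logb_iff_rpow_le (by norm_num) hm0, Real.rpow_natCast] at h4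
    exact_mod_cast h4
  refine lt_trans ?_ (lt_of_mem_complexityBounds h3 (isLeast_eqComplexity m).1)
  have := logb_two_three_pos
  gcongr

theorem lt_atomEqComplexity (M : ℕ) (hM : 3 ≤ M) : (atomEqComplexity RRA M : ℝ) >
    2 * Real.logb 2 3 * (Real.logb 3 ((M : ℝ) / 2 - 1) - 2) - 2 := by
  have hc := logb_two_three_pos
  rcases lt_or_ge M 8 with h8 | h8
  -- The smallest witness (`n = 0`) has 8 atoms; for `M < 8` the right-hand side is negative.
  · have hM3 : (3 : ℝ) ≤ M := by exact_mod_cast hM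
    have hM8 : (M : ℝ) < 8 := by exact_mod_cast h8
    have h1 : Real.logb 3 ((M : ℝ) / 2 - 1) < 1 := by
      rw [Real.logb_lt_iff_lt_rpow (by norm_num) (by linarith), Real.rpow_one]
      linarith
    have h2 : (0 : ℝ) ≤ atomEqComplexity RRA M := Nat.cast_nonneg _
    nlinarith
  · have hM8 : (8 : ℝ) ≤ M := by exact_mod_cast h8
    obtain ⟨n, h1, h2⟩ := exists_odd_pow_le (x := (M : ℝ) / 2 - 1) (by linarith)
    have h3 : 2 * 3 ^ (2 * n + 1) + 2 ≤ M := by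
      have h4 : (((2 * 3 ^ (2 * n + 1) + 2 : ℕ)) : ℝ) ≤ M := by
        push_cast; linarith
      exact_mod_cast h4
    refine lt_trans ?_ (lt_of_mem_atomComplexityBounds h3 (isLeast_atomEqComplexity M).1)
    gcongr

theorem log_log_isBigO_eqComplexity : (fun m : ℕ => Real.log (Real.log (m : ℝ)))
    =O[Filter.atTop] fun m : ℕ => (eqComplexity RRA m : ℝ) := by
  have htend : Filter.Tendsto (fun m : ℕ => Real.log (Real.log (m : ℝ))) Filter.atTop
      Filter.atTop :=
    Real.tendsto_log_atTop.comp (Real.tendsto_log_atTop.comp tendsto_natCast_atTop_atTop)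
  refine Asymptotics.IsBigO.of_bound 1 ?_
  -- With `L = log log m` the bound gives `β(m) > 2 (L - log 36) - 2`, which is at least `L` once `L
  -- ≥ 2 log 36 + 2`. Here `36 = 4 · 3²` collects the factor `1/4` of `log m` and the summand `-2`
  -- under `log₃`.
  filter_upwards [Filter.eventually_ge_atTop (2 ^ 8),
    htend.eventually_ge_atTop (2 * Real.log 36 + 2)] with m hm hlog
  have h36 : 0 < Real.log 36 := Real.log_pos (by norm_num)
  have hβ := lt_eqComplexity m hm
  rw [Real.norm_of_nonneg (by linarith), Real.norm_of_nonneg (Nat.cast_nonneg _), one_mul]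
  have hm' : ((2 ^ 8 : ℕ) : ℝ) ≤ m := by exact_mod_cast hm
  have hm0 : (0 : ℝ) < m := lt_of_lt_of_le (by norm_num) hm'
  have h8 : 8 ≤ Real.logb 2 m := by
    rw [Real.le_logb_iff_rpow_le (by norm_num) hm0]
    exact_mod_cast hm
  have hl2 : 0 < Real.log 2 := Real.log_pos (by norm_num)
  have hl2' : Real.log 2 < 1 := by
    have := Real.log_two_lt_d9; linarith
  have hl3 : 0 < Real.log 3 := Real.log_pos (by norm_num)
  have hy : 0 < Real.log m := Real.log_pos (by
    have : (1 : ℝ) < (2 ^ 8 : ℕ) := by norm_num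
    linarith)
  have hyl : Real.log m ≤ Real.logb 2 m := by
    rw [Real.logb, le_div_iff₀ hl2]
    nlinarith
  have h1 : Real.logb 3 (Real.log m / 4) ≤ Real.logb 3 (1 / 2 * Real.logb 2 m - 1) :=
    Real.logb_le_logb_of_le (by norm_num) (by linarith) (by linarith)
  have h2 : Real.logb 3 (Real.log m / 4) - 2 = (Real.log (Real.log m) - Real.log 36) / Real.log 3 := by
    rw [Real.logb, Real.log_div hy.ne' (by norm_num),
      show (36 : ℝ) = 4 * 3 ^ 2 by norm_num, Real.log_mul (by norm_num) (by norm_num),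
      Real.log_pow]
    field_simp
    push_cast
    ring
  have h3 : 2 * Real.logb 2 3 * ((Real.log (Real.log m) - Real.log 36) / Real.log 3) =
      2 * ((Real.log (Real.log m) - Real.log 36) / Real.log 2) := by
    rw [Real.logb]; field_simp
  have h4 : Real.log (Real.log m) - Real.log 36 ≤
      (Real.log (Real.log m) - Real.log 36) / Real.log 2 := by
    rw [le_div_iff₀ hl2]
    nlinarith
  have h5 : 2 * Real.logb 2 3 * (Real.logb 3 (Real.log m / 4) - 2) ≤
      2 * Real.logb 2 3 * (Real.logb 3 (1 / 2 * Real.logb 2 m - 1) - 2) := by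
    have := logb_two_three_pos
    gcongr
  rw [h2, h3] at h5
  linarith

theorem mainTheorem1 :
    -- `β_V` and `β*_V` exist, that is, the minima that define them are attained
    (∀ m : ℕ, IsLeast (complexityBounds RRA m) (eqComplexity RRA m)) ∧
    (∀ M : ℕ, IsLeast (atomComplexityBounds RRA M) (atomEqComplexity RRA M)) ∧
    -- the bound at the special cardinalities
    (∀ n : ℕ, (eqComplexity RRA (2 ^ (2 * 3 ^ (2 * n + 1) + 2)) : ℝ) >
      2 * Real.logb 2 3 * (2 * (n : ℝ) + 1) - 2) ∧
    -- the bound in terms of the cardinality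
    (∀ m : ℕ, 2 ^ 8 ≤ m → (eqComplexity RRA m : ℝ) >
      2 * Real.logb 2 3 * (Real.logb 3 (1 / 2 * Real.logb 2 (m : ℝ) - 1) - 2) - 2) ∧
    -- growth at least like a log-log function
    ((fun m : ℕ => Real.log (Real.log (m : ℝ))) =O[Filter.atTop]
      fun m : ℕ => (eqComplexity RRA m : ℝ)) ∧
    -- the bound in terms of the number of atoms
    (∀ M : ℕ, 3 ≤ M → (atomEqComplexity RRA M : ℝ) >
      2 * Real.logb 2 3 * (Real.logb 3 ((M : ℝ) / 2 - 1) - 2) - 2) := by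
  refine ⟨isLeast_eqComplexity, isLeast_atomEqComplexity, fun n => ?_, lt_eqComplexity,
    log_log_isBigO_eqComplexity, lt_atomEqComplexity⟩
  exact lt_of_mem_complexityBounds le_rfl (isLeast_eqComplexity _).1
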